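/- **Notation.** Write $e(t)=e^{2\pi i t}$ and $(\sigma)_p=\sigma(\sigma+1)\cdots(\sigma+p-1)$, $(\sigma)_0=1$. For $\sigma\in\mathbb R$, a pair $(\kappa,\lambda)$ of real numbers with $0\le\kappa\le\frac12\le\lambda\le1$ is called an *exponent pair for $\sigma$* if there are an integer $P\ge1$, a real number $0<\varepsilon<\frac12$ and a constant $C$, depending only on $\kappa,\lambda,\sigma$, such that $$\Bigl|\sum_{a\le n\le b}e(f(n))\Bigr|\le C\bigl(L^{\kappa}X^{\lambda}+L^{-1}\bigr),\qquad L=yX^{-\sigma},$$ for all real $X\ge1$, $y>0$, all $X\le a<b\le 2X$, and all $f$ with $P$ continuous derivatives on $[a,b]$ satisfying $$\bigl|f^{(p+1)}(x)-(-1)^p(\sigma)_p\,y\,x^{-\sigma-p}\bigr|<\varepsilon\,|(\sigma)_p|\,y\,x^{-\sigma-p}\qquad(0\le p\le P-1,\ a\le x\le b).$$ (The classical notion of an exponent pair requires this for every $\sigma>0$.) For $c>1$ and positive integers $s,N$ let $Q_c(s;N)$ be the number of integers $1\le n\le N$ such that $\lfloor n^c\rfloor=sm^2$ for some integer $m$.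 **Theorem.** Let $c>1$, $c\notin\mathbb N$, put $\gamma=1/c$, and let $(\kappa,\lambda)$ be an exponent pair for $\sigma=1-2\gamma$, that is, for phases modelled on $x^{2\gamma}$ (if $c>2$, then $\sigma>0$ and every classical exponent pair qualifies). Then, as $N\to\infty$, $$Q_c(s;N)=\gamma(2\gamma-1)^{-1}s^{-1/2}N^{1-c/2}+O\bigl(s^{-\rho_1}N^{\vartheta_1+o(1)}+s^{-\rho_2}N^{\vartheta_2+o(1)}\bigr)$$ uniformly in all integers $s\ge1$, where $$\rho_1=\frac{\lambda}{2(\kappa+1)},\quad \vartheta_1=\frac{2\kappa+c\lambda}{2(1+\kappa)},\quad \rho_2=\frac{\lambda-\kappa}{2},\quad \vartheta_2=\frac{2\kappa+c(\lambda-\kappa)}{2}.$$ That is, there are a constant $C>0$ and a function $\delta(N)\to0$, both depending only on $c,\kappa,\lambda$, such that for all integers $N,s\ge1$ the difference between $Q_c(s;N)$ and the main term is at most $C\bigl(s^{-\rho_1}N^{\vartheta_1+\delta(N)}+s^{-\rho_2}N^{\vartheta_2+\delta(N)}\bigr)$ in absolute value. -/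

import Mathlib

open Filter Topology

/-- `SquareCount c s N` is the number of integers `1 ≤ n ≤ N` such that `⌊n ^ c⌋ = s * m ^ 2`
for some integer `m`. -/
noncomputable def SquareCount (c : ℝ) (s N : ℕ) : ℕ :=
  open Classical in
  ((Finset.Icc 1 N).filter fun n : ℕ => ∃ m : ℤ, ⌊(n : ℝ) ^ c⌋ = (s : ℤ) * m ^ 2).card

/-- The usual class of phases `f` whose derivative is modelled on `y * x ^ (-σ)`: `f` has `P`
continuous derivatives on `[a, b] ⊆ [X, 2 * X]`, and there
`|f⁽ᵖ⁺¹⁾(x) - (-1)ᵖ (σ)ₚ y x^(-σ-p)| < ε |(σ)ₚ| y x^(-σ-p)` for `0 ≤ p ≤ P - 1`,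
where `(σ)ₚ = σ (σ + 1) ⋯ (σ + p - 1)`; that is, `f⁽ᵖ⁺¹⁾` is within a factor `1 ± ε` of the
`p`-th derivative of `y * x ^ (-σ)`. -/
structure IsPhase (X : ℝ) (P : ℕ) (σ y ε a b : ℝ) (f : ℝ → ℝ) : Prop where
  lower : X ≤ a
  lt : a < b
  upper : b ≤ 2 * X
  contDiffOn : ContDiffOn ℝ P f (Set.Icc a b)
  approx : ∀ p < P, ∀ x ∈ Set.Icc a b,
    |iteratedDerivWithin (p + 1) f (Set.Icc a b) x
        - (-1) ^ p * (ascPochhammer ℝ p).eval σ * y * x ^ (-σ - p)|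
      < ε * |(ascPochhammer ℝ p).eval σ| * y * x ^ (-σ - p)

/-- `(κ, l)` is an exponent pair for phases modelled on `f' = y * x ^ (-σ)`: one has
`0 ≤ κ ≤ 1/2 ≤ l ≤ 1`, and for a suitable number `P` of derivatives and a suitable tolerance
`ε < 1/2` (depending only on `κ, l, σ`) all phases `f` of the class above satisfy
`∑_{a ≤ n ≤ b} e(f(n)) ≪ L ^ κ * X ^ l + L⁻¹` with `L = y * X ^ (-σ)`, where
`e(t) = exp(2πit)` and the implied constant depends only on `κ, l, σ`. -/
def IsExponentPair (σ κ l : ℝ) : Prop :=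
  0 ≤ κ ∧ κ ≤ 1 / 2 ∧ 1 / 2 ≤ l ∧ l ≤ 1 ∧
  ∃ P : ℕ, 1 ≤ P ∧ ∃ ε : ℝ, 0 < ε ∧ ε < 1 / 2 ∧ ∃ C : ℝ,
    ∀ (X y a b : ℝ) (f : ℝ → ℝ), 1 ≤ X → 0 < y → IsPhase X P σ y ε a b f →
      ‖∑ n ∈ Finset.Icc ⌈a⌉ ⌊b⌋, Complex.exp (2 * Real.pi * Complex.I * (f n : ℂ))‖
        ≤ C * ((y * X ^ (-σ)) ^ κ * X ^ l + (y * X ^ (-σ))⁻¹)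

noncomputable def rho₁ (κ l : ℝ) : ℝ := l / (2 * (κ + 1))

noncomputable def theta₁ (c κ l : ℝ) : ℝ := (2 * κ + c * l) / (2 * (1 + κ))

noncomputable def rho₂ (κ l : ℝ) : ℝ := (l - κ) / 2

noncomputable def theta₂ (c κ l : ℝ) : ℝ := (2 * κ + c * (l - κ)) / 2

/-! Put R = √(N^c/s). The condition ⌊n^c⌋ = s m² says that n lies in the half-open interval from (s
m²)^γ to (s m² + 1)^γ, and n ≤ N corresponds exactly to m ≤ R. Hence the count is a sum over 1 ≤ m ≤
R of differences of ceilings (`squareCount_eq_sum`). Each difference is the length of the interval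
plus a difference of two sawtooth values. The lengths add up to the main term with error O(s^(γ-1))
(`abs_sum_length_sub_le`).

For the sawtooth sums, split m into dyadic blocks of size X and write T = (s X²)^γ. Smoothing the
sawtooth on scale d and applying the exponent pair to the phases h (s m² + θ)^γ, θ = 0 or 1, bounds
a block, up to a logarithm, by X d + d^(-κ) (T/X)^κ X^l + X/T. The choice d = E/X with E =
X^(l/(1+κ)) T^(κ/(1+κ)) balances the first two terms. The third is at most E when X ≤ T². When T² ≤
X, disjointness of the intervals gives the bound O(T), and T ≤ E (`exists_abs_sum_gapError_le`).

Since E increases with X, every block is bounded by the value at X = R, where T = N; this value is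
the first error term. The logarithms go into N^δ(N). -/

/-! ### Sawtooth sums in terms of exponential sums -/

/-- The sawtooth function `{x} - 1/2`. -/
noncomputable def sawtooth (x : ℝ) : ℝ := Int.fract x - 1 / 2

/-- The periodic primitive `B₂({x}) / 2` of the sawtooth function. -/
noncomputable def sawtoothPrimitive (x : ℝ) : ℝ := (Int.fract x ^ 2 - Int.fract x + 1 / 6) / 2

lemma hasSum_sawtoothPrimitive (x : ℝ) :
    HasSum (fun n : ℕ => Real.cos (2 * Real.pi * n * x) / (n : ℝ) ^ 2)
      (2 * Real.pi ^ 2 * sawtoothPrimitive x) := by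
  have h := hasSum_one_div_nat_pow_mul_cos (k := 1) one_ne_zero
    (x := Int.fract x) ⟨Int.fract_nonneg x, (Int.fract_lt_one x).le⟩
  convert h using 1
  · funext n
    have hx : 2 * Real.pi * n * x
        = 2 * Real.pi * n * Int.fract x + ((n * ⌊x⌋ : ℤ) : ℝ) * (2 * Real.pi) := by
      have := Int.floor_add_fract x
      push_cast
      linear_combination (-2 * Real.pi * n) * this
    rw [hx, Real.cos_add_int_mul_two_pi]
    ring
  · simp [Polynomial.bernoulli_def, Finset.sum_range_succ, sawtoothPrimitive, bernoulli_two,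
      bernoulli_one, Nat.choose]
    ring

/-- The quotient is the mean of the sawtooth over [x - d, x]. The sawtooth has slope 1 and only
downward jumps, so at distance v to the left of x it is at least its value at x minus v; averaging
over v costs d/2. The lower bound uses [x, x + d] in the same way. -/
lemma sawtooth_le_primitive {x d : ℝ} (hd : 0 < d) (hd1 : d ≤ 1) :
    sawtooth x ≤ d / 2 + (sawtoothPrimitive x - sawtoothPrimitive (x - d)) / d := by
  have h0 := Int.fract_nonneg x
  have h1 := Int.fract_lt_one x
  have hf := Int.floor_add_fract x
  rw [← sub_le_iff_le_add', le_div_iff₀ hd]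
  unfold sawtooth sawtoothPrimitive
  rcases le_or_gt d (Int.fract x) with h | h
  · have : Int.fract (x - d) = Int.fract x - d :=
      Int.fract_eq_iff.2 ⟨by linarith, by linarith, ⌊x⌋, by linarith⟩
    rw [this]
    nlinarith
  · have : Int.fract (x - d) = Int.fract x - d + 1 :=
      Int.fract_eq_iff.2 ⟨by linarith, by linarith, ⌊x⌋ - 1, by push_cast; linarith⟩
    rw [this]
    nlinarith

lemma primitive_le_sawtooth {x d : ℝ} (hd : 0 < d) (hd1 : d ≤ 1) :
    (sawtoothPrimitive (x + d) - sawtoothPrimitive x) / d - d / 2 ≤ sawtooth x := by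
  have h0 := Int.fract_nonneg x
  have h1 := Int.fract_lt_one x
  have hf := Int.floor_add_fract x
  rw [sub_le_iff_le_add, div_le_iff₀ hd]
  unfold sawtooth sawtoothPrimitive
  rcases lt_or_ge (Int.fract x + d) 1 with h | h
  · have : Int.fract (x + d) = Int.fract x + d :=
      Int.fract_eq_iff.2 ⟨by linarith, by linarith, ⌊x⌋, by linarith⟩
    rw [this]
    nlinarith
  · have : Int.fract (x + d) = Int.fract x + d - 1 :=
      Int.fract_eq_iff.2 ⟨by linarith, by linarith, ⌊x⌋ + 1, by push_cast; linarith⟩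
    rw [this]
    nlinarith

/-- Exponential sums `∑ e(h xᵢ)`. -/
noncomputable def expSum {ι : Type*} (s : Finset ι) (x : ι → ℝ) (h : ℕ) : ℂ :=
  ∑ i ∈ s, Complex.exp (2 * Real.pi * Complex.I * ((h * x i : ℝ) : ℂ))

/-- The decay of the Fourier coefficients of the smoothed sawtooth function. -/
noncomputable def fourierWeight (d : ℝ) (h : ℕ) : ℝ := min (1 / (d * (h : ℝ) ^ 2)) (1 / (h : ℝ))

lemma fourierWeight_nonneg {d : ℝ} (hd : 0 < d) (h : ℕ) : 0 ≤ fourierWeight d h :=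
  le_min (by positivity) (by positivity)

lemma fourierWeight_zero (d : ℝ) : fourierWeight d 0 = 0 := by simp [fourierWeight]

lemma abs_sum_cos_sub_cos_le {ι : Type*} (s : Finset ι) (x : ι → ℝ) {d t : ℝ} (hd : 0 < d)
    (ht : |t| = d) (h : ℕ) :
    |∑ i ∈ s, (Real.cos (2 * Real.pi * h * x i) / (h : ℝ) ^ 2
        - Real.cos (2 * Real.pi * h * (x i + t)) / (h : ℝ) ^ 2)|
      ≤ 2 * Real.pi ^ 2 * d * (fourierWeight d h * ‖expSum s x h‖) := by
  rcases Nat.eq_zero_or_pos h with rfl | hh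
  · simp [fourierWeight_zero]
  have hh' : (0 : ℝ) < h := by exact_mod_cast hh
  set z : ℂ := Complex.exp (Complex.I * ((2 * Real.pi * h * t : ℝ) : ℂ)) with hz
  have key : ∑ i ∈ s, (Real.cos (2 * Real.pi * h * x i) / (h : ℝ) ^ 2
        - Real.cos (2 * Real.pi * h * (x i + t)) / (h : ℝ) ^ 2)
      = (((1 - z) * expSum s x h).re) / (h : ℝ) ^ 2 := by
    rw [expSum, Finset.mul_sum, Complex.re_sum, Finset.sum_div]
    refine Finset.sum_congr rfl fun i _ => ?_
    rw [← sub_div]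
    congr 1
    rw [sub_mul, one_mul, hz, ← Complex.exp_add, Complex.sub_re]
    congr 1
    · rw [← Complex.exp_ofReal_mul_I_re]
      congr 2
      push_cast; ring
    · rw [← Complex.exp_ofReal_mul_I_re]
      congr 2
      push_cast; ring
  -- The trivial bound serves for large h and the Lipschitz bound for small h; they give the two
  -- entries of the minimum in `fourierWeight`.
  have hz1 : ‖1 - z‖ ≤ 2 := by
    refine (norm_sub_le _ _).trans ?_
    rw [hz, Complex.norm_exp_I_mul_ofReal]
    norm_num
  have hz2 : ‖1 - z‖ ≤ 2 * Real.pi * h * d := by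
    rw [norm_sub_rev, hz]
    refine Real.norm_exp_I_mul_ofReal_sub_one_le.trans ?_
    rw [Real.norm_eq_abs, abs_mul, ht, abs_of_nonneg (by positivity)]
  have hpi := Real.pi_gt_three
  have hw : ‖1 - z‖ / (h : ℝ) ^ 2 ≤ 2 * Real.pi ^ 2 * d * fourierWeight d h := by
    rw [fourierWeight, mul_min_of_nonneg _ _ (by positivity)]
    refine le_min ?_ ?_
    · calc ‖1 - z‖ / (h : ℝ) ^ 2 ≤ (2 * Real.pi ^ 2) / (h : ℝ) ^ 2 := by gcongr; nlinarith
        _ = _ := by field_simp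
    · calc ‖1 - z‖ / (h : ℝ) ^ 2 ≤ (2 * Real.pi * h * d) / (h : ℝ) ^ 2 := by gcongr
        _ = 2 * Real.pi * d * (1 / h) := by field_simp
        _ ≤ _ := by gcongr; nlinarith
  rw [key, abs_div, abs_of_nonneg (by positivity : (0 : ℝ) ≤ (h : ℝ) ^ 2)]
  calc |((1 - z) * expSum s x h).re| / (h : ℝ) ^ 2
      ≤ ‖(1 - z) * expSum s x h‖ / (h : ℝ) ^ 2 := by gcongr; exact Complex.abs_re_le_norm _
    _ = ‖1 - z‖ / (h : ℝ) ^ 2 * ‖expSum s x h‖ := by rw [norm_mul]; ring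
    _ ≤ 2 * Real.pi ^ 2 * d * fourierWeight d h * ‖expSum s x h‖ := by gcongr
    _ = _ := by ring

lemma abs_sum_primitive_sub_le {ι : Type*} (s : Finset ι) (x : ι → ℝ) {d t : ℝ} (hd : 0 < d)
    (ht : |t| = d) {g : ℕ → ℝ} (hg : ∀ h : ℕ, 1 ≤ h → ‖expSum s x h‖ ≤ g h) {G : ℝ}
    (hG : HasSum (fun h => fourierWeight d h * g h) G) :
    |∑ i ∈ s, (sawtoothPrimitive (x i) - sawtoothPrimitive (x i + t))| / d ≤ G := by
  have h1 : HasSum (fun h : ℕ => ∑ i ∈ s, (Real.cos (2 * Real.pi * h * x i) / (h : ℝ) ^ 2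
        - Real.cos (2 * Real.pi * h * (x i + t)) / (h : ℝ) ^ 2))
      (∑ i ∈ s, (2 * Real.pi ^ 2 * sawtoothPrimitive (x i)
        - 2 * Real.pi ^ 2 * sawtoothPrimitive (x i + t))) :=
    hasSum_sum fun i _ => (hasSum_sawtoothPrimitive _).sub (hasSum_sawtoothPrimitive _)
  have h2 := h1.norm_le_of_bounded (hG.mul_left (2 * Real.pi ^ 2 * d)) fun h => by
    rw [Real.norm_eq_abs]
    refine (abs_sum_cos_sub_cos_le s x hd ht h).trans ?_
    rcases Nat.eq_zero_or_pos h with rfl | hh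
    · simp [fourierWeight_zero]
    · have := fourierWeight_nonneg hd h
      have := hg h hh
      gcongr
  have hpi := Real.pi_pos
  simp_rw [← mul_sub, ← Finset.mul_sum] at h2
  rw [Real.norm_eq_abs, abs_mul, abs_of_pos (by positivity : 0 < 2 * Real.pi ^ 2), mul_assoc] at h2
  have h3 : |∑ i ∈ s, (sawtoothPrimitive (x i) - sawtoothPrimitive (x i + t))| ≤ d * G :=
    le_of_mul_le_mul_left (a := 2 * Real.pi ^ 2) (by linarith) (by positivity)
  rw [div_le_iff₀ hd]
  linarith

lemma abs_sum_sawtooth_le {ι : Type*} (s : Finset ι) (x : ι → ℝ) {d : ℝ} (hd : 0 < d)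
    (hd1 : d ≤ 1) {g : ℕ → ℝ} (hg : ∀ h : ℕ, 1 ≤ h → ‖expSum s x h‖ ≤ g h) {G : ℝ}
    (hG : HasSum (fun h => fourierWeight d h * g h) G) :
    |∑ i ∈ s, sawtooth (x i)| ≤ s.card * (d / 2) + G := by
  have up := abs_sum_primitive_sub_le s x hd (t := -d) (by rw [abs_neg, abs_of_pos hd]) hg hG
  have lo := abs_sum_primitive_sub_le s x hd (t := d) (abs_of_pos hd) hg hG
  have e1 : ∑ i ∈ s, sawtooth (x i) ≤ s.card * (d / 2)
      + (∑ i ∈ s, (sawtoothPrimitive (x i) - sawtoothPrimitive (x i + -d))) / d := by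
    rw [← nsmul_eq_mul, ← Finset.sum_const, Finset.sum_div, ← Finset.sum_add_distrib]
    exact Finset.sum_le_sum fun i _ => sawtooth_le_primitive hd hd1
  have e2 : -(s.card * (d / 2))
      - (∑ i ∈ s, (sawtoothPrimitive (x i) - sawtoothPrimitive (x i + d))) / d
        ≤ ∑ i ∈ s, sawtooth (x i) := by
    rw [← nsmul_eq_mul, ← Finset.sum_const, Finset.sum_div, ← neg_add', ← Finset.sum_add_distrib,
      ← Finset.sum_neg_distrib]
    refine Finset.sum_le_sum fun i _ => le_trans (le_of_eq ?_) (primitive_le_sawtooth hd hd1)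
    ring
  have a1 := le_abs_self (∑ i ∈ s, (sawtoothPrimitive (x i) - sawtoothPrimitive (x i + -d)))
  have a2 := le_abs_self (∑ i ∈ s, (sawtoothPrimitive (x i) - sawtoothPrimitive (x i + d)))
  have b1 := (div_le_div_of_nonneg_right a1 hd.le).trans up
  have b2 := (div_le_div_of_nonneg_right a2 hd.le).trans lo
  rw [abs_le]
  constructor <;> linarith

lemma sum_range_min_le {d : ℝ} (hd : 0 < d) (hd1 : d ≤ 1) (n : ℕ) :
    ∑ h ∈ Finset.range n, min (1 / ((h : ℝ) + 1)) (1 / (√d * √((h : ℝ) + 1) ^ 3))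
      ≤ 4 * (1 + Real.log (1 / d)) := by
  set a : ℕ → ℝ := fun h => min (1 / ((h : ℝ) + 1)) (1 / (√d * √((h : ℝ) + 1) ^ 3)) with ha
  have hlogd : 0 ≤ Real.log (1 / d) := Real.log_nonneg (by rw [le_div_iff₀ hd]; linarith)
  -- The two entries of the minimum cross near 1/d: below H the sum is harmonic, beyond H it is
  -- dominated by a telescoping sum of differences of 1/√m.
  obtain ⟨H, hH1, hH2, hH3⟩ : ∃ H : ℕ, 1 ≤ H ∧ 1 / d ≤ H ∧ (H : ℝ) ≤ 2 / d := by
    have h1d : 1 ≤ 1 / d := by rw [le_div_iff₀ hd]; linarith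
    refine ⟨⌈1 / d⌉₊, Nat.one_le_ceil_iff.2 (by positivity), Nat.le_ceil _, ?_⟩
    have := (Nat.ceil_lt_add_one (by positivity : 0 ≤ 1 / d)).le
    have e : 2 / d = 1 / d + 1 / d := by ring
    linarith
  have hHpos : (0 : ℝ) < H := by exact_mod_cast hH1
  have small : ∀ m ≤ H, ∑ h ∈ Finset.range m, a h ≤ 2 + Real.log (1 / d) := by
    intro m hm
    have h1 : ∑ h ∈ Finset.range m, a h ≤ ∑ h ∈ Finset.range H, a h :=
      Finset.sum_le_sum_of_subset_of_nonneg (by simpa using hm)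
        fun h _ _ => le_min (by positivity) (by positivity)
    have h2 : ∑ h ∈ Finset.range H, a h ≤ ((harmonic H : ℚ) : ℝ) := by
      rw [harmonic]
      push_cast
      refine Finset.sum_le_sum fun h _ => (min_le_left _ _).trans ?_
      rw [one_div]
    have h3 := harmonic_le_one_add_log H
    have h4 : Real.log H ≤ Real.log 2 + Real.log (1 / d) := by
      rw [← Real.log_mul (by norm_num) (by positivity)]
      exact Real.log_le_log hHpos (by rw [mul_one_div]; exact hH3)
    have := Real.log_two_lt_d9
    linarith
  rcases le_total n H with hn | hn
  · linarith [small n hn]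
  · have hsd : 0 < √d := Real.sqrt_pos.2 hd
    have key : ∑ h ∈ Finset.range n, a h ≤ 2 + Real.log (1 / d) + 2 / √d * (1 / √H - 1 / √n) := by
      induction n, hn using Nat.le_induction with
      | base => simpa using small H le_rfl
      | succ m hm ih =>
        rw [Finset.sum_range_succ]
        have hmpos : (0 : ℝ) < m := by exact_mod_cast (lt_of_lt_of_le hH1 hm)
        have p : 0 < √(m : ℝ) := Real.sqrt_pos.2 hmpos
        have q : 0 < √((m : ℝ) + 1) := Real.sqrt_pos.2 (by positivity)
        have hpq : √(m : ℝ) ≤ √((m : ℝ) + 1) := Real.sqrt_le_sqrt (by linarith)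
        have hp2 := Real.sq_sqrt hmpos.le
        have hq2 := Real.sq_sqrt (by positivity : (0 : ℝ) ≤ (m : ℝ) + 1)
        have step : a m ≤ 2 / √d * (1 / √m - 1 / √((m : ℝ) + 1)) := by
          refine (min_le_right _ _).trans ?_
          set u := √(m : ℝ)
          set v := √((m : ℝ) + 1)
          have e : 1 / u - 1 / v = 1 / (u * v * (u + v)) := by
            field_simp
            nlinarith
          rw [e, ← div_div, div_mul_div_comm, mul_one, div_div,
            div_le_div_iff₀ (by positivity) (by positivity)]
          have hv : u * v * (u + v) ≤ 2 * v ^ 3 := by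
            calc u * v * (u + v) ≤ v * v * (v + v) := by gcongr
              _ = 2 * v ^ 3 := by ring
          nlinarith
        push_cast
        nlinarith [ih]
    have h1 : 2 / √d * (1 / √H - 1 / √n) ≤ 2 := by
      have : 1 / √H ≤ √d := by
        rw [div_le_iff₀ (Real.sqrt_pos.2 hHpos), ← Real.sqrt_mul hd.le, Real.one_le_sqrt]
        rw [div_le_iff₀ hd] at hH2
        linarith
      have h0 : 0 ≤ 1 / √(n : ℝ) := by positivity
      calc 2 / √d * (1 / √H - 1 / √n) ≤ 2 / √d * √d := by gcongr; linarith
        _ = 2 := by field_simp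
    linarith

/-- Write h^κ = d^(-κ) (dh)^κ. As 0 ≤ κ ≤ 1/2, the factor (dh)^κ is at most 1 for dh ≤ 1 and at most
√(dh) otherwise, which leaves a convergent majorant independent of κ. -/
lemma sum_range_fourierWeight_rpow_le {d κ : ℝ} (hd : 0 < d) (hd1 : d ≤ 1) (hκ : 0 ≤ κ)
    (hκ' : κ ≤ 1 / 2) (n : ℕ) :
    ∑ h ∈ Finset.range n, fourierWeight d h * (h : ℝ) ^ κ
      ≤ 4 * (1 + Real.log (1 / d)) * d ^ (-κ) := by
  have hpt : ∀ h : ℕ, fourierWeight d (h + 1) * ((h + 1 : ℕ) : ℝ) ^ κ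
      ≤ d ^ (-κ) * min (1 / ((h : ℝ) + 1)) (1 / (√d * √((h : ℝ) + 1) ^ 3)) := by
    intro h
    have ht : (0 : ℝ) < (h : ℝ) + 1 := by positivity
    push_cast
    unfold fourierWeight
    push_cast
    set t := (h : ℝ) + 1
    have hdt : t ^ κ = d ^ (-κ) * (d * t) ^ κ := by
      rw [Real.mul_rpow hd.le ht.le, ← mul_assoc, ← Real.rpow_add hd]
      simp
    rw [hdt, mul_left_comm]
    refine mul_le_mul_of_nonneg_left ?_ (by positivity)
    have hs : (√d * √t) ^ 2 = d * t := by
      rw [mul_pow, Real.sq_sqrt hd.le, Real.sq_sqrt ht.le]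
    have hsp : 0 < √d * √t := mul_pos (Real.sqrt_pos.2 hd) (Real.sqrt_pos.2 ht)
    have ht2 : √t ^ 2 = t := Real.sq_sqrt ht.le
    have hd2 : √d ^ 2 = d := Real.sq_sqrt hd.le
    have e0 : 1 / (√d * √t ^ 3) = 1 / t * (1 / (√d * √t)) := by
      field_simp
      exact ht2.symm
    have e1 : 1 / (d * t ^ 2) = 1 / t * (1 / (√d * √t)) * (1 / (√d * √t)) := by
      rw [mul_assoc, one_div_mul_one_div, one_div_mul_one_div, ← sq, hs]
      congr 1; ring
    rcases le_total (d * t) 1 with h1 | h1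
    · have hs1 : √d * √t ≤ 1 := by nlinarith
      have hi : 1 ≤ 1 / (√d * √t) := by rw [le_div_iff₀ hsp]; linarith
      have hle : (d * t) ^ κ ≤ 1 := Real.rpow_le_one (by positivity) h1 hκ
      have hmin : 1 / t ≤ 1 / (√d * √t ^ 3) := by
        rw [e0]; exact le_mul_of_one_le_right (by positivity) hi
      rw [min_eq_left hmin]
      calc min (1 / (d * t ^ 2)) (1 / t) * (d * t) ^ κ ≤ 1 / t * 1 := by
            gcongr
            exact min_le_right _ _
        _ = _ := mul_one _
    · have hs1 : 1 ≤ √d * √t := by nlinarith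
      have hi : 1 / (√d * √t) ≤ 1 := by rw [div_le_one hsp]; exact hs1
      have hle : (d * t) ^ κ ≤ √d * √t := by
        rw [← Real.sqrt_mul hd.le, Real.sqrt_eq_rpow]
        exact Real.rpow_le_rpow_of_exponent_le h1 hκ'
      have hmin : 1 / (√d * √t ^ 3) ≤ 1 / t := by
        rw [e0]; exact mul_le_of_le_one_right (by positivity) hi
      rw [min_eq_right hmin]
      calc min (1 / (d * t ^ 2)) (1 / t) * (d * t) ^ κ ≤ 1 / (d * t ^ 2) * (√d * √t) := by
            gcongr
            exact min_le_left _ _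
        _ = _ := by rw [e1, e0]; field_simp
  rcases n with _ | n
  · have : 0 ≤ Real.log (1 / d) := Real.log_nonneg (by rw [le_div_iff₀ hd]; linarith)
    simp only [Finset.range_zero, Finset.sum_empty]
    positivity
  · rw [Finset.sum_range_succ', fourierWeight_zero, zero_mul, add_zero]
    refine (Finset.sum_le_sum fun h _ => hpt h).trans ?_
    rw [← Finset.mul_sum, mul_comm]
    gcongr
    exact sum_range_min_le hd hd1 n

/-- A sawtooth sum is small if the exponential sums are bounded as for an exponent pair. -/
lemma abs_sum_sawtooth_le_of_expSum_le {ι : Type*} (s : Finset ι) (x : ι → ℝ) {d κ A B : ℝ}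
    (hd : 0 < d) (hd1 : d ≤ 1) (hκ : 0 ≤ κ) (hκ' : κ ≤ 1 / 2) (hA : 0 ≤ A) (hB : 0 ≤ B)
    (hx : ∀ h : ℕ, 1 ≤ h → ‖expSum s x h‖ ≤ (h : ℝ) ^ κ * A + B / h) :
    |∑ i ∈ s, sawtooth (x i)|
      ≤ s.card * (d / 2) + 4 * (1 + Real.log (1 / d)) * (d ^ (-κ) * A + B) := by
  have hw := fourierWeight_nonneg hd
  -- Weakening B/h to h^0 B lets the same weight estimate, with exponent 0, handle both terms.
  have hx' : ∀ h : ℕ, 1 ≤ h → ‖expSum s x h‖ ≤ (h : ℝ) ^ κ * A + (h : ℝ) ^ (0 : ℝ) * B := by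
    intro h hh
    refine (hx h hh).trans ?_
    rw [Real.rpow_zero, one_mul]
    gcongr
    exact div_le_self hB (by exact_mod_cast hh)
  have hnn : ∀ h : ℕ, 0 ≤ fourierWeight d h * ((h : ℝ) ^ κ * A + (h : ℝ) ^ (0 : ℝ) * B) :=
    fun h => mul_nonneg (hw h) (by positivity)
  have hbd : ∀ n, ∑ h ∈ Finset.range n,
      fourierWeight d h * ((h : ℝ) ^ κ * A + (h : ℝ) ^ (0 : ℝ) * B)
        ≤ 4 * (1 + Real.log (1 / d)) * (d ^ (-κ) * A + B) := by
    intro n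
    have h1 := sum_range_fourierWeight_rpow_le hd hd1 hκ hκ' n
    have h2 := sum_range_fourierWeight_rpow_le hd hd1 le_rfl (by norm_num : (0 : ℝ) ≤ 1 / 2) n
    rw [neg_zero, Real.rpow_zero d, mul_one] at h2
    have h1' := mul_le_mul_of_nonneg_right h1 hA
    have h2' := mul_le_mul_of_nonneg_right h2 hB
    rw [Finset.sum_mul] at h1' h2'
    calc _ = ∑ h ∈ Finset.range n, fourierWeight d h * (h : ℝ) ^ κ * A
          + ∑ h ∈ Finset.range n, fourierWeight d h * (h : ℝ) ^ (0 : ℝ) * B := by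
            rw [← Finset.sum_add_distrib]
            exact Finset.sum_congr rfl fun h _ => by ring
      _ ≤ _ := by linarith
  have hsum := summable_of_sum_range_le hnn hbd
  have h1 := abs_sum_sawtooth_le s x hd hd1 hx' hsum.hasSum
  have h2 := Real.tsum_le_of_sum_range_le hnn hbd
  linarith

/-! ### The phases (s m² + θ)^γ and the exponent pair -/

open Polynomial in
/-- The polynomials `P_q` for which the `q`-th derivative of `(x ^ 2 + η) ^ γ` equals
`x ^ (-q) * (x ^ 2 + η) ^ γ * P_q (x ^ 2 / (x ^ 2 + η))`. -/
noncomputable def phasePoly (γ : ℝ) : ℕ → ℝ[X]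
  | 0 => 1
  | q + 1 => (C (2 * γ) * X - C (q : ℝ)) * phasePoly γ q
      + C 2 * X * (1 - X) * derivative (phasePoly γ q)

/-- The `q`-th derivative of `(x ^ 2 + η) ^ γ`. -/
noncomputable def phaseDeriv (γ η : ℝ) (q : ℕ) (x : ℝ) : ℝ :=
  x ^ (-(q : ℝ)) * (x ^ 2 + η) ^ γ * (phasePoly γ q).eval (x ^ 2 / (x ^ 2 + η))

/-- The argument 1 corresponds to η = 0, the pure power x^(2γ): the derivative term of the recursion
carries the factor 1 - X and drops out, leaving the product 2γ(2γ - 1)⋯(2γ - p). -/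
lemma phasePoly_eval_one (γ : ℝ) (p : ℕ) :
    (phasePoly γ (p + 1)).eval 1
      = 2 * γ * ((-1) ^ p * (ascPochhammer ℝ p).eval (1 - 2 * γ)) := by
  induction p with
  | zero => simp [phasePoly]
  | succ p ih =>
    rw [phasePoly, ascPochhammer_succ_eval]
    simp only [Polynomial.eval_add, Polynomial.eval_mul, Polynomial.eval_sub, Polynomial.eval_C,
      Polynomial.eval_X, Polynomial.eval_one, ih]
    push_cast
    ring

lemma hasDerivAt_phaseDeriv (γ : ℝ) {η x : ℝ} (hη : 0 ≤ η) (hx : 0 < x) (q : ℕ) :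
    HasDerivAt (phaseDeriv γ η q) (phaseDeriv γ η (q + 1) x) x := by
  have hw : 0 < x ^ 2 + η := by positivity
  have d1 : HasDerivAt (fun x : ℝ => x ^ (-(q : ℝ))) (-(q : ℝ) * x ^ (-(q : ℝ) - 1)) x :=
    Real.hasDerivAt_rpow_const (Or.inl hx.ne')
  have d0 : HasDerivAt (fun x : ℝ => x ^ 2 + η) (2 * x) x := by
    simpa using (hasDerivAt_pow 2 x).add_const η
  have d2 : HasDerivAt (fun x : ℝ => (x ^ 2 + η) ^ γ) (2 * x * γ * (x ^ 2 + η) ^ (γ - 1)) x :=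
    d0.rpow_const (Or.inl hw.ne')
  have d3 : HasDerivAt (fun x : ℝ => x ^ 2 / (x ^ 2 + η))
      ((2 * x * (x ^ 2 + η) - x ^ 2 * (2 * x)) / (x ^ 2 + η) ^ 2) x := by
    have : HasDerivAt (fun x : ℝ => x ^ 2) (2 * x) x := by simpa using hasDerivAt_pow 2 x
    exact this.div d0 hw.ne'
  have d4 := ((phasePoly γ q).hasDerivAt (x ^ 2 / (x ^ 2 + η))).comp x d3
  refine ((d1.mul d2).mul d4).congr_deriv ?_
  simp only [Function.comp, phaseDeriv, phasePoly, Polynomial.eval_add, Polynomial.eval_mul,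
    Polynomial.eval_sub, Polynomial.eval_C, Polynomial.eval_X, Polynomial.eval_one, Pi.mul_apply]
  have e1 : x ^ (-(q : ℝ) - 1) = x ^ (-(q : ℝ)) / x := Real.rpow_sub_one hx.ne' _
  have e2 : x ^ (-((q + 1 : ℕ) : ℝ)) = x ^ (-(q : ℝ)) / x := by
    rw [← e1]; push_cast; congr 1; ring
  have e3 : (x ^ 2 + η) ^ (γ - 1) = (x ^ 2 + η) ^ γ / (x ^ 2 + η) := Real.rpow_sub_one hw.ne' _
  rw [e1, e2, e3]
  field_simp
  ring

lemma iteratedDerivWithin_phase (γ c : ℝ) {η a b : ℝ} (hη : 0 ≤ η) (ha : 0 < a) (hab : a < b)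
    (q : ℕ) : ∀ x ∈ Set.Icc a b,
      iteratedDerivWithin q (fun x : ℝ => c * (x ^ 2 + η) ^ γ) (Set.Icc a b) x
        = c * phaseDeriv γ η q x := by
  induction q with
  | zero =>
    intro x _
    simp [phaseDeriv, phasePoly]
  | succ q ih =>
    intro x hx
    rw [iteratedDerivWithin_succ, derivWithin_congr ih (ih x hx)]
    exact ((hasDerivAt_phaseDeriv γ hη (ha.trans_le hx.1) q).const_mul c).hasDerivWithinAt.derivWithin
      (uniqueDiffOn_Icc hab x hx)

lemma ascPochhammer_eval_ne_zero {σ : ℝ} (h1 : -1 < σ) (h0 : σ ≠ 0) (p : ℕ) :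
    (ascPochhammer ℝ p).eval σ ≠ 0 := by
  induction p with
  | zero => simp
  | succ p ih =>
    rw [ascPochhammer_succ_eval]
    refine mul_ne_zero ih ?_
    rcases Nat.eq_zero_or_pos p with rfl | hp
    · simpa using h0
    · have : (1 : ℝ) ≤ p := by exact_mod_cast hp
      linarith

/-- The functions `c * (x ^ 2 + η) ^ γ` are phases modelled on `x ^ (2 * γ)`, as soon as `η` is
small compared with `x ^ 2`. -/
lemma exists_isPhase {γ : ℝ} (hγ0 : 0 < γ) (hγ1 : γ < 1) (hγ2 : γ ≠ 1 / 2) (P : ℕ) {ε : ℝ}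
    (hε : 0 < ε) :
    ∃ τ : ℝ, 0 < τ ∧ ∀ X a b η c : ℝ, 1 ≤ X → X ≤ a → a < b → b ≤ 2 * X → 0 ≤ η →
      η < τ * X ^ 2 → 0 < c →
      IsPhase X P (1 - 2 * γ) (2 * γ * c) ε a b (fun x => c * (x ^ 2 + η) ^ γ) := by
  have hne := ascPochhammer_eval_ne_zero (σ := 1 - 2 * γ) (by linarith)
    (fun h => hγ2 (by linarith))
  -- After division by the power of x, each derivative depends only on t = η/x² and is continuous at
  -- t = 0. As the model value there is nonzero, the tolerance is positive, and finitely many p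
  -- allow one common τ.
  have hev : ∀ᶠ t : ℝ in 𝓝 0, ∀ p ∈ Finset.range P,
      |(1 + t) ^ γ * (phasePoly γ (p + 1)).eval (1 / (1 + t)) - (phasePoly γ (p + 1)).eval 1|
        < ε * |(phasePoly γ (p + 1)).eval 1| := by
    rw [Filter.eventually_all_finset]
    intro p _
    have hcont : ContinuousAt (fun t : ℝ =>
        |(1 + t) ^ γ * (phasePoly γ (p + 1)).eval (1 / (1 + t))
          - (phasePoly γ (p + 1)).eval 1|) 0 := by
      have c1 : ContinuousAt (fun t : ℝ => 1 + t) 0 := by fun_prop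
      have c2 : ContinuousAt (fun t : ℝ => (1 + t) ^ γ) 0 :=
        c1.rpow_const (Or.inl (by norm_num))
      have c3 : ContinuousAt (fun t : ℝ => 1 / (1 + t)) 0 :=
        continuousAt_const.div c1 (by norm_num)
      have c4 : ContinuousAt (fun t : ℝ => (phasePoly γ (p + 1)).eval (1 / (1 + t))) 0 :=
        ((phasePoly γ (p + 1)).continuous.continuousAt).comp c3
      exact ((c2.mul c4).sub continuousAt_const).abs
    refine hcont.eventually_lt continuousAt_const ?_
    have h0 : (phasePoly γ (p + 1)).eval 1 ≠ 0 := by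
      rw [phasePoly_eval_one]
      exact mul_ne_zero (by positivity) (mul_ne_zero (by simp) (hne p))
    simp only [add_zero, Real.one_rpow, one_mul, div_one, sub_self, abs_zero]
    positivity
  obtain ⟨τ, hτ, hball⟩ := Metric.eventually_nhds_iff.1 hev
  refine ⟨τ, hτ, fun X a b η c hX hXa hab hb hη hητ hc => ⟨hXa, hab, hb, ?_, ?_⟩⟩
  · refine contDiffOn_const.mul (ContDiffOn.rpow_const_of_ne (by fun_prop) fun x hx => ?_)
    have : 0 < x := by linarith [hx.1]
    positivity
  · intro p hp x hx
    have hx0 : 0 < x := by linarith [hx.1]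
    rw [iteratedDerivWithin_phase γ c hη (by linarith) hab _ x hx]
    have hXx : X ^ 2 ≤ x ^ 2 := pow_le_pow_left₀ (by linarith) (hXa.trans hx.1) 2
    have ht0 : 0 ≤ η / x ^ 2 := by positivity
    have htτ : η / x ^ 2 < τ := by
      rw [div_lt_iff₀ (by positivity)]
      nlinarith
    have hb := hball (y := η / x ^ 2) (by
      rw [Real.dist_eq, sub_zero, abs_of_nonneg ht0]; exact htτ) p (Finset.mem_range.2 hp)
    set t := η / x ^ 2 with ht
    have e1 : x ^ 2 + η = x ^ 2 * (1 + t) := by rw [ht]; field_simp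
    have e2 : x ^ 2 / (x ^ 2 + η) = 1 / (1 + t) := by
      rw [e1]; field_simp
    have e3 : (x ^ 2 + η) ^ γ = x ^ (2 * γ) * (1 + t) ^ γ := by
      rw [e1, Real.mul_rpow (by positivity) (by positivity), ← Real.rpow_natCast,
        ← Real.rpow_mul hx0.le]
      norm_num
    have e4 : x ^ (-((p + 1 : ℕ) : ℝ)) * x ^ (2 * γ) = x ^ (-(1 - 2 * γ) - p) := by
      rw [← Real.rpow_add hx0]; congr 1; push_cast; ring
    have hpow : 0 < x ^ (-(1 - 2 * γ) - p) := Real.rpow_pos_of_pos hx0 _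
    have e5 : c * phaseDeriv γ η (p + 1) x
        - (-1) ^ p * (ascPochhammer ℝ p).eval (1 - 2 * γ) * (2 * γ * c)
          * x ^ (-(1 - 2 * γ) - p)
        = c * x ^ (-(1 - 2 * γ) - p) * ((1 + t) ^ γ * (phasePoly γ (p + 1)).eval (1 / (1 + t))
          - (phasePoly γ (p + 1)).eval 1) := by
      rw [phaseDeriv, e2, e3, phasePoly_eval_one, ← e4]
      ring
    rw [e5, abs_mul, abs_of_pos (by positivity)]
    refine (mul_lt_mul_of_pos_left hb (by positivity)).trans_eq ?_
    rw [phasePoly_eval_one, abs_mul (2 * γ), abs_mul ((-1) ^ p), abs_pow, abs_neg, abs_one, one_pow, one_mul,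
      abs_of_pos (by positivity : 0 < 2 * γ)]
    ring

/-- The exponential sum bound furnished by an exponent pair. -/
lemma exists_norm_expSum_le {γ κ l : ℝ} (hγ0 : 0 < γ) (hγ1 : γ < 1) (hγ2 : γ ≠ 1 / 2)
    (hpair : IsExponentPair (1 - 2 * γ) κ l) :
    ∃ X₀ : ℝ, ∃ C : ℝ, 0 < C ∧ ∀ X Y s h : ℕ, ∀ θ : ℝ, X₀ ≤ X → 1 ≤ X → X ≤ Y →
      Y + 1 ≤ 2 * X → 1 ≤ s → 1 ≤ h → 0 ≤ θ → θ ≤ 1 →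
      ‖expSum (Finset.Icc X Y) (fun m : ℕ => ((s : ℝ) * (m : ℝ) ^ 2 + θ) ^ γ) h‖
        ≤ C * ((h : ℝ) ^ κ * (((s : ℝ) * (X : ℝ) ^ 2) ^ γ / X) ^ κ * (X : ℝ) ^ l
          + X / ((s : ℝ) * (X : ℝ) ^ 2) ^ γ / h) := by
  obtain ⟨hκ0, hκ1, hl0, hl1, P, -, ε, hε, -, C, hC⟩ := hpair
  obtain ⟨τ, hτ, hphase⟩ := exists_isPhase hγ0 hγ1 hγ2 P hε
  -- The threshold ensures θ/s ≤ 1 < τX ≤ τX². The powers of 2γ come from L = 2γ h T/X, and |C| + 1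
  -- replaces C, whose sign is unknown.
  refine ⟨1 / τ + 1, (|C| + 1) * (2 * γ) ^ κ + (|C| + 1) / (2 * γ), by positivity, ?_⟩
  intro X Y s h θ hX0 hX1 hXY hY hs hh hθ0 hθ1
  have hX : (1 : ℝ) ≤ X := by exact_mod_cast hX1
  have hs' : (1 : ℝ) ≤ s := by exact_mod_cast hs
  have hh' : (1 : ℝ) ≤ h := by exact_mod_cast hh
  have hXY' : (X : ℝ) ≤ Y := by exact_mod_cast hXY
  have hY' : (Y : ℝ) + 1 ≤ 2 * X := by exact_mod_cast hY
  have hη : θ / s < τ * (X : ℝ) ^ 2 := by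
    have h1 : θ / s ≤ 1 := (div_le_one (by linarith)).2 (by linarith)
    have h2 : 1 / τ < X := by linarith
    rw [div_lt_iff₀ hτ] at h2
    nlinarith
  -- The right end Y + 1/2 keeps the interval nondegenerate when X = Y without adding an integer.
  have hph := hphase X X (Y + 1 / 2) (θ / s) (h * (s : ℝ) ^ γ) hX le_rfl (by linarith)
    (by linarith) (by positivity) hη (by positivity)
  have hfl : ⌊(Y : ℝ) + 1 / 2⌋ = (Y : ℤ) := by
    rw [Int.floor_eq_iff]; push_cast; constructor <;> linarith
  have hb := hC X _ X _ _ hX (by positivity) hph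
  have himg : Finset.Icc (X : ℤ) Y = (Finset.Icc X Y).image (fun n : ℕ => (n : ℤ)) := by
    apply Finset.coe_injective
    push_cast
    exact (Nat.image_cast_int_Icc X Y).symm
  rw [Int.ceil_natCast, hfl, himg, Finset.sum_image (fun _ _ _ _ => by simp)] at hb
  have hsum : expSum (Finset.Icc X Y) (fun m : ℕ => ((s : ℝ) * (m : ℝ) ^ 2 + θ) ^ γ) h
      = ∑ n ∈ Finset.Icc X Y, Complex.exp (2 * Real.pi * Complex.I
        * ((h * (s : ℝ) ^ γ * ((((n : ℕ) : ℤ) : ℝ) ^ 2 + θ / s) ^ γ : ℝ) : ℂ)) := by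
    refine Finset.sum_congr rfl fun n _ => ?_
    have : ((s : ℝ) * (n : ℝ) ^ 2 + θ) ^ γ = (s : ℝ) ^ γ * ((n : ℝ) ^ 2 + θ / s) ^ γ := by
      rw [← Real.mul_rpow (by positivity) (by positivity)]
      congr 1; field_simp
    beta_reduce
    rw [this, Int.cast_natCast]
    congr 3
    ring
  rw [hsum]
  refine hb.trans ?_
  have hX0' : (0 : ℝ) < X := by linarith
  set T := ((s : ℝ) * (X : ℝ) ^ 2) ^ γ with hT
  have hTp : 0 < T := by positivity
  have hL : 2 * γ * (h * (s : ℝ) ^ γ) * (X : ℝ) ^ (-(1 - 2 * γ)) = 2 * γ * h * (T / X) := by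
    rw [hT, Real.mul_rpow (by positivity) (by positivity), ← Real.rpow_natCast,
      ← Real.rpow_mul hX0'.le, neg_sub, Real.rpow_sub_one hX0'.ne']
    push_cast
    ring
  rw [hL, Real.mul_rpow (by positivity) (by positivity), Real.mul_rpow (by positivity)
    (by positivity)]
  have hCC : C ≤ |C| + 1 := by linarith [le_abs_self C]
  set U := (h : ℝ) ^ κ * (T / X) ^ κ * (X : ℝ) ^ l with hU
  have hU0 : 0 ≤ U := by positivity
  have hV0 : 0 ≤ X / T / h := by positivity
  have e1 : (2 * γ) ^ κ * (h : ℝ) ^ κ * (T / X) ^ κ * (X : ℝ) ^ l + (2 * γ * h * (T / X))⁻¹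
      = (2 * γ) ^ κ * U + 1 / (2 * γ) * (X / T / h) := by
    rw [hU]; field_simp
  rw [e1]
  have hg : 0 ≤ (2 * γ) ^ κ := by positivity
  have hg' : 0 ≤ 1 / (2 * γ) := by positivity
  have hE : 0 ≤ |C| + 1 := by positivity
  calc C * ((2 * γ) ^ κ * U + 1 / (2 * γ) * (X / T / h))
      ≤ (|C| + 1) * ((2 * γ) ^ κ * U + 1 / (2 * γ) * (X / T / h)) := by gcongr
    _ = (|C| + 1) * (2 * γ) ^ κ * U + (|C| + 1) / (2 * γ) * (X / T / h) := by ring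
    _ ≤ (|C| + 1) * (2 * γ) ^ κ * U + (|C| + 1) / (2 * γ) * (X / T / h)
        + ((|C| + 1) * (2 * γ) ^ κ * (X / T / h) + (|C| + 1) / (2 * γ) * U) := by
      have : 0 ≤ (|C| + 1) * (2 * γ) ^ κ * (X / T / h) + (|C| + 1) / (2 * γ) * U := by positivity
      linarith
    _ = _ := by ring

/-! ### Counting error of the intervals -/

/-- The left end of the interval of `n` with `s * m ^ 2 ≤ n ^ (1 / γ) < s * m ^ 2 + 1`. -/
noncomputable def leftEnd (γ : ℝ) (s m : ℕ) : ℝ := ((s : ℝ) * (m : ℝ) ^ 2) ^ γ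

/-- The right end of the interval of `n` with `s * m ^ 2 ≤ n ^ (1 / γ) < s * m ^ 2 + 1`. -/
noncomputable def rightEnd (γ : ℝ) (s m : ℕ) : ℝ := ((s : ℝ) * (m : ℝ) ^ 2 + 1) ^ γ

/-- The number of integers in `[leftEnd, rightEnd)` minus the length of this interval. -/
noncomputable def gapError (γ : ℝ) (s m : ℕ) : ℝ :=
  ((⌈rightEnd γ s m⌉ - ⌈leftEnd γ s m⌉ : ℤ) : ℝ) - (rightEnd γ s m - leftEnd γ s m)

lemma ceil_sub_self (x : ℝ) : (⌈x⌉ : ℝ) - x = sawtooth (-x) + 1 / 2 := by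
  rw [sawtooth, ← Int.self_sub_floor, Int.floor_neg]
  push_cast
  ring

lemma gapError_eq (γ : ℝ) (s m : ℕ) :
    gapError γ s m = sawtooth (-rightEnd γ s m) - sawtooth (-leftEnd γ s m) := by
  have h1 := ceil_sub_self (rightEnd γ s m)
  have h2 := ceil_sub_self (leftEnd γ s m)
  rw [gapError]
  push_cast
  linarith

lemma abs_gapError_le (γ : ℝ) (s m : ℕ) : |gapError γ s m| ≤ 1 := by
  rw [gapError_eq, sawtooth, sawtooth, abs_le]
  have h1 := Int.fract_nonneg (-rightEnd γ s m)
  have h2 := Int.fract_lt_one (-rightEnd γ s m)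
  have h3 := Int.fract_nonneg (-leftEnd γ s m)
  have h4 := Int.fract_lt_one (-leftEnd γ s m)
  constructor <;> linarith

lemma abs_sum_gapError_le_card (γ : ℝ) (s : ℕ) (S : Finset ℕ) :
    |∑ m ∈ S, gapError γ s m| ≤ S.card := by
  refine (Finset.abs_sum_le_sum_abs _ _).trans ?_
  refine (Finset.sum_le_sum fun m _ => abs_gapError_le γ s m).trans ?_
  simp

lemma leftEnd_le_rightEnd {γ : ℝ} (hγ : 0 ≤ γ) (s m : ℕ) : leftEnd γ s m ≤ rightEnd γ s m :=
  Real.rpow_le_rpow (by positivity) (by linarith) hγ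

lemma rightEnd_le_leftEnd_succ {γ : ℝ} (hγ : 0 ≤ γ) {s : ℕ} (hs : 1 ≤ s) (m : ℕ) :
    rightEnd γ s m ≤ leftEnd γ s (m + 1) := by
  have hs' : (1 : ℝ) ≤ s := by exact_mod_cast hs
  refine Real.rpow_le_rpow (by positivity) ?_ hγ
  push_cast
  have : 0 ≤ (s : ℝ) * m := by positivity
  nlinarith

lemma sum_Icc_succ_sub (f : ℕ → ℝ) {X Y : ℕ} (h : X ≤ Y) :
    ∑ m ∈ Finset.Icc X Y, (f (m + 1) - f m) = f (Y + 1) - f X := by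
  induction Y, h using Nat.le_induction with
  | base => simp
  | succ n hn ih =>
    rw [← Finset.insert_Icc_right_eq_Icc_add_one (by omega), Finset.sum_insert (by simp), ih]
    ring

/-- The intervals follow one another without overlap, so the number of integers in them and their
total length both lie between 0 and the bound. This is better than the trivial bound when the
intervals are many but all lie in a short range. -/
lemma abs_sum_gapError_le_leftEnd {γ : ℝ} (hγ : 0 ≤ γ) {X Y s : ℕ} (hXY : X ≤ Y) (hs : 1 ≤ s) :
    |∑ m ∈ Finset.Icc X Y, gapError γ s m| ≤ leftEnd γ s (Y + 1) + 1 := by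
  have hc : ∑ m ∈ Finset.Icc X Y, ((⌈rightEnd γ s m⌉ - ⌈leftEnd γ s m⌉ : ℤ) : ℝ)
      ≤ leftEnd γ s (Y + 1) + 1 := by
    have h1 : ∑ m ∈ Finset.Icc X Y, ((⌈rightEnd γ s m⌉ - ⌈leftEnd γ s m⌉ : ℤ) : ℝ)
        ≤ ∑ m ∈ Finset.Icc X Y, ((⌈leftEnd γ s (m + 1)⌉ : ℝ) - (⌈leftEnd γ s m⌉ : ℝ)) := by
      refine Finset.sum_le_sum fun m _ => ?_
      push_cast
      have : (⌈rightEnd γ s m⌉ : ℝ) ≤ ⌈leftEnd γ s (m + 1)⌉ := by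
        exact_mod_cast Int.ceil_mono (rightEnd_le_leftEnd_succ hγ hs m)
      linarith
    rw [sum_Icc_succ_sub (fun m => (⌈leftEnd γ s m⌉ : ℝ)) hXY] at h1
    have h2 := (Int.ceil_lt_add_one (leftEnd γ s (Y + 1))).le
    have h3 : (0 : ℝ) ≤ ⌈leftEnd γ s X⌉ :=
      le_trans (by unfold leftEnd; positivity) (Int.le_ceil (leftEnd γ s X))
    linarith
  have hc0 : 0 ≤ ∑ m ∈ Finset.Icc X Y, ((⌈rightEnd γ s m⌉ - ⌈leftEnd γ s m⌉ : ℤ) : ℝ) := by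
    refine Finset.sum_nonneg fun m _ => ?_
    exact_mod_cast sub_nonneg.2 (Int.ceil_mono (leftEnd_le_rightEnd hγ s m))
  have hl : ∑ m ∈ Finset.Icc X Y, (rightEnd γ s m - leftEnd γ s m) ≤ leftEnd γ s (Y + 1) := by
    have h1 : ∑ m ∈ Finset.Icc X Y, (rightEnd γ s m - leftEnd γ s m)
        ≤ ∑ m ∈ Finset.Icc X Y, (leftEnd γ s (m + 1) - leftEnd γ s m) :=
      Finset.sum_le_sum fun m _ => by linarith [rightEnd_le_leftEnd_succ hγ hs m]
    rw [sum_Icc_succ_sub (leftEnd γ s) hXY] at h1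
    have h3 : 0 ≤ leftEnd γ s X := by unfold leftEnd; positivity
    linarith
  have hl0 : 0 ≤ ∑ m ∈ Finset.Icc X Y, (rightEnd γ s m - leftEnd γ s m) :=
    Finset.sum_nonneg fun m _ => sub_nonneg.2 (leftEnd_le_rightEnd hγ s m)
  simp_rw [gapError]
  rw [Finset.sum_sub_distrib, abs_le]
  constructor <;> linarith

lemma norm_expSum_neg {ι : Type*} (s : Finset ι) (x : ι → ℝ) (h : ℕ) :
    ‖expSum s (fun i => -x i) h‖ = ‖expSum s x h‖ := by
  rw [← Complex.norm_conj (expSum s x h), expSum, expSum, map_sum]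
  congr 1
  refine Finset.sum_congr rfl fun i _ => ?_
  rw [← Complex.exp_conj]
  congr 1
  simp only [map_mul, Complex.conj_I, Complex.conj_ofReal, map_ofNat]
  push_cast
  ring

/-! ### Balancing and the estimate for a dyadic block -/

/-- The size of the error term coming from `m` of size `X`, where `T = (s * X ^ 2) ^ γ`. -/
noncomputable def errorSize (κ l X T : ℝ) : ℝ := X ^ (l / (1 + κ)) * T ^ (κ / (1 + κ))

lemma one_le_errorSize {κ l X T : ℝ} (hκ : 0 ≤ κ) (hl : 1 / 2 ≤ l) (hX : 1 ≤ X)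
    (hT : 1 ≤ T) : 1 ≤ errorSize κ l X T :=
  one_le_mul_of_one_le_of_one_le (Real.one_le_rpow hX (by positivity))
    (Real.one_le_rpow hT (by positivity))

lemma le_errorSize_of_sq_le {κ l X T : ℝ} (hκ : 0 ≤ κ) (hl : 1 / 2 ≤ l) (hT : 1 ≤ T)
    (h : T ^ 2 ≤ X) : T ≤ errorSize κ l X T := by
  have hT0 : 0 < T := by linarith
  have e : 1 ≤ 2 * (l / (1 + κ)) + κ / (1 + κ) := by
    rw [← mul_div_assoc, ← add_div, le_div_iff₀ (by positivity)]; linarith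
  calc T = T ^ (1 : ℝ) := (Real.rpow_one T).symm
    _ ≤ T ^ (2 * (l / (1 + κ)) + κ / (1 + κ)) := Real.rpow_le_rpow_of_exponent_le hT e
    _ = (T ^ 2) ^ (l / (1 + κ)) * T ^ (κ / (1 + κ)) := by
      rw [Real.rpow_add hT0, Real.rpow_mul hT0.le]; norm_num
    _ ≤ errorSize κ l X T := by
      unfold errorSize
      gcongr

/-- At X = T² this and the preceding bound both reduce to 2l + κ ≥ 1 + κ, that is, to l ≥ 1/2; this
is why T² = X separates the two regimes. -/
lemma div_le_errorSize_of_le_sq {κ l X T : ℝ} (hκ : 0 ≤ κ) (hl : 1 / 2 ≤ l) (hX : 1 ≤ X)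
    (hT : 1 ≤ T) (hl1 : l ≤ 1) (h : X ≤ T ^ 2) : X / T ≤ errorSize κ l X T := by
  have hT0 : 0 < T := by linarith
  have hX0 : 0 < X := by linarith
  have hk : 0 < 1 + κ := by positivity
  have e : 1 ≤ 2 * (l / (1 + κ)) + κ / (1 + κ) := by
    rw [← mul_div_assoc, ← add_div, le_div_iff₀ hk]; linarith
  have e1 : l / (1 + κ) ≤ 1 := by rw [div_le_one hk]; linarith
  have h1 : X ^ (1 - l / (1 + κ)) ≤ T ^ (1 + κ / (1 + κ)) := by
    calc X ^ (1 - l / (1 + κ)) ≤ (T ^ 2) ^ (1 - l / (1 + κ)) :=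
          Real.rpow_le_rpow hX0.le h (by linarith)
      _ = T ^ (2 * (1 - l / (1 + κ))) := by rw [Real.rpow_mul hT0.le]; norm_num
      _ ≤ _ := Real.rpow_le_rpow_of_exponent_le hT (by linarith)
  rw [div_le_iff₀ hT0, errorSize]
  calc X = X ^ (l / (1 + κ)) * X ^ (1 - l / (1 + κ)) := by
        rw [← Real.rpow_add hX0]; simp
    _ ≤ X ^ (l / (1 + κ)) * T ^ (1 + κ / (1 + κ)) := by gcongr
    _ = _ := by rw [Real.rpow_add hT0, Real.rpow_one]; ring

/-- The balancing equation: E^(1+κ) = X^l T^κ, so for d = E/X the smoothing loss X d and the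
exponent-pair term are both equal to E. -/
lemma errorSize_div_rpow_mul {κ l X T : ℝ} (hκ : 0 ≤ κ) (hl : 1 / 2 ≤ l) (hX : 1 ≤ X)
    (hT : 1 ≤ T) :
    (errorSize κ l X T / X) ^ (-κ) * ((T / X) ^ κ * X ^ l) = errorSize κ l X T := by
  have hT0 : 0 < T := by linarith
  have hX0 : 0 < X := by linarith
  have hE : 0 < errorSize κ l X T := by linarith [one_le_errorSize hκ hl hX hT]
  have hk : 0 < 1 + κ := by positivity
  have h1 : errorSize κ l X T * errorSize κ l X T ^ κ = X ^ l * T ^ κ := by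
    rw [← Real.rpow_one_add' hE.le hk.ne', errorSize,
      Real.mul_rpow (by positivity) (by positivity), ← Real.rpow_mul hX0.le,
      ← Real.rpow_mul hT0.le, div_mul_cancel₀ _ hk.ne', div_mul_cancel₀ _ hk.ne']
  rw [Real.rpow_neg (by positivity), Real.div_rpow hE.le hX0.le, Real.div_rpow hT0.le hX0.le]
  have p1 : 0 < errorSize κ l X T ^ κ := by positivity
  have p2 : 0 < X ^ κ := by positivity
  field_simp
  linarith

/-- The sum of the errors over a dyadic block. -/
lemma exists_abs_sum_gapError_le {γ κ l : ℝ} (hγ0 : 0 < γ) (hγ1 : γ < 1) (hγ2 : γ ≠ 1 / 2)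
    (hpair : IsExponentPair (1 - 2 * γ) κ l) :
    ∃ K : ℝ, 0 < K ∧ ∀ X Y s : ℕ, 1 ≤ X → X ≤ Y → Y + 1 ≤ 2 * X → 1 ≤ s →
      |∑ m ∈ Finset.Icc X Y, gapError γ s m|
        ≤ K * (1 + Real.log X) * errorSize κ l X (leftEnd γ s X) := by
  obtain ⟨X₀, C, hC0, hC⟩ := exists_norm_expSum_le hγ0 hγ1 hγ2 hpair
  obtain ⟨hκ0, hκ1, hl0, hl1, -⟩ := hpair
  -- One summand per regime: |X₀| for X below the threshold, 5 for T² ≤ X (from 4T + 1), and 1 + 16C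
  -- for two sawtooth sums, one for each endpoint. The case X ≤ E needs only 1.
  refine ⟨|X₀| + 5 + (1 + 16 * C), by positivity, ?_⟩
  intro X Y s hX1 hXY hY hs
  have hX : (1 : ℝ) ≤ X := by exact_mod_cast hX1
  have hs' : (1 : ℝ) ≤ s := by exact_mod_cast hs
  have hY' : (Y : ℝ) + 1 ≤ 2 * X := by exact_mod_cast hY
  have hT : 1 ≤ leftEnd γ s X := by
    refine Real.one_le_rpow ?_ hγ0.le
    nlinarith
  have hE := one_le_errorSize hκ0 hl0 hX hT
  set T := leftEnd γ s X with hTdef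
  set E := errorSize κ l X T with hEdef
  have hlog : 0 ≤ Real.log X := Real.log_nonneg hX
  have hE0 : 0 < E := by linarith
  have hX0 : (0 : ℝ) < X := by linarith
  have hT0 : 0 < T := by linarith
  have hcard : ((Finset.Icc X Y).card : ℝ) ≤ X := by
    rw [Nat.card_Icc]
    exact_mod_cast (by omega : Y + 1 - X ≤ X)
  have htriv := (abs_sum_gapError_le_card γ s (Finset.Icc X Y)).trans hcard
  have hLE : E ≤ (1 + Real.log X) * E := le_mul_of_one_le_left hE0.le (by linarith)
  have hLE0 : 0 ≤ (1 + Real.log X) * E := by positivity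
  have fin : ∀ c : ℝ, c ≤ |X₀| + 5 + (1 + 16 * C) →
      c * ((1 + Real.log X) * E) ≤ (|X₀| + 5 + (1 + 16 * C)) * (1 + Real.log X) * E := by
    intro c hc
    rw [mul_assoc _ (1 + Real.log X) E]
    gcongr
  rcases lt_or_ge (X : ℝ) X₀ with hsmall | hlarge
  · refine (htriv.trans ?_).trans (fin |X₀| (by linarith))
    have : (X : ℝ) ≤ |X₀| := hsmall.le.trans (le_abs_self _)
    calc (X : ℝ) ≤ |X₀| * 1 := by linarith
      _ ≤ _ := by gcongr; linarith
  rcases le_total (T ^ 2) X with hTX | hTX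
  · refine le_trans ?_ (fin 5 (by have := abs_nonneg X₀; linarith))
    have h1 := abs_sum_gapError_le_leftEnd hγ0.le hXY hs
    have h2 : leftEnd γ s (Y + 1) ≤ 4 * T := by
      calc leftEnd γ s (Y + 1) ≤ (4 * ((s : ℝ) * (X : ℝ) ^ 2)) ^ γ := by
            refine Real.rpow_le_rpow (by positivity) ?_ hγ0.le
            push_cast
            have : ((Y : ℝ) + 1) ^ 2 ≤ (2 * X) ^ 2 := by gcongr
            nlinarith
        _ = 4 ^ γ * T := Real.mul_rpow (by norm_num) (by positivity)
        _ ≤ 4 * T := by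
            gcongr
            calc (4 : ℝ) ^ γ ≤ 4 ^ (1 : ℝ) :=
                  Real.rpow_le_rpow_of_exponent_le (by norm_num) hγ1.le
              _ = 4 := Real.rpow_one 4
    have h3 := le_errorSize_of_sq_le hκ0 hl0 hT hTX
    linarith
  rcases le_total (X : ℝ) E with hEX | hEX
  · refine (htriv.trans ?_).trans (fin 1 (by have := abs_nonneg X₀; linarith))
    linarith
  have hd : 0 < E / X := by positivity
  have hd1 : E / X ≤ 1 := (div_le_one hX0).2 hEX
  have saw : ∀ θ : ℝ, 0 ≤ θ → θ ≤ 1 →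
      |∑ m ∈ Finset.Icc X Y, sawtooth (-((s : ℝ) * (m : ℝ) ^ 2 + θ) ^ γ)|
        ≤ E / 2 + 8 * C * ((1 + Real.log X) * E) := by
    intro θ h0 h1
    have hb := abs_sum_sawtooth_le_of_expSum_le (Finset.Icc X Y)
      (fun m : ℕ => -((s : ℝ) * (m : ℝ) ^ 2 + θ) ^ γ) (κ := κ)
      (A := C * ((T / X) ^ κ * (X : ℝ) ^ l)) (B := C * (X / T)) hd hd1 hκ0 hκ1 (by positivity)
      (by positivity) (fun h hh => by
        rw [norm_expSum_neg]
        refine (hC X Y s h θ hlarge hX1 hXY hY hs hh h0 h1).trans (le_of_eq ?_)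
        rw [hTdef, leftEnd]
        ring)
    refine hb.trans ?_
    have a1 : ((Finset.Icc X Y).card : ℝ) * (E / X / 2) ≤ E / 2 := by
      calc _ ≤ (X : ℝ) * (E / X / 2) := by gcongr
        _ = E / 2 := by field_simp
    have a2 : Real.log (1 / (E / X)) ≤ Real.log X := by
      refine Real.log_le_log (by positivity) ?_
      rw [one_div_div]
      exact div_le_self hX0.le hE
    have a3 : (E / X) ^ (-κ) * (C * ((T / X) ^ κ * (X : ℝ) ^ l)) + C * (X / T) ≤ 2 * C * E := by
      have b1 := errorSize_div_rpow_mul hκ0 hl0 hX hT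
      have b2 := div_le_errorSize_of_le_sq hκ0 hl0 hX hT hl1 hTX
      rw [mul_left_comm, b1]
      nlinarith
    have a4 : 0 ≤ (E / X) ^ (-κ) * (C * ((T / X) ^ κ * (X : ℝ) ^ l)) + C * (X / T) := by positivity
    have a5 : 4 * (1 + Real.log (1 / (E / X)))
        * ((E / X) ^ (-κ) * (C * ((T / X) ^ κ * (X : ℝ) ^ l)) + C * (X / T))
        ≤ 4 * (1 + Real.log X) * (2 * C * E) := by gcongr
    linarith
  have s0 := saw 0 le_rfl zero_le_one
  have s1 := saw 1 zero_le_one le_rfl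
  simp only [add_zero] at s0
  refine le_trans ?_ (fin (1 + 16 * C) (by have := abs_nonneg X₀; linarith))
  simp_rw [gapError_eq, rightEnd, leftEnd]
  rw [Finset.sum_sub_distrib]
  refine (abs_sub _ _).trans ?_
  linarith

/-! ### Summation over dyadic blocks -/

lemma abs_sum_Icc_one_le_of_dyadic {f : ℕ → ℝ} {B : ℝ} (hB : 0 ≤ B) {M : ℕ}
    (h : ∀ X Y : ℕ, 1 ≤ X → X ≤ Y → Y + 1 ≤ 2 * X → Y ≤ M → |∑ m ∈ Finset.Icc X Y, f m| ≤ B) :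
    |∑ m ∈ Finset.Icc 1 M, f m| ≤ (Nat.log 2 M + 1) * B := by
  suffices H : ∀ Z ≤ M, |∑ m ∈ Finset.Icc 1 Z, f m| ≤ (Nat.log 2 Z + 1) * B from H M le_rfl
  intro Z
  induction Z using Nat.strong_induction_on with
  | _ Z ih =>
    intro hZ
    rcases Nat.lt_or_ge Z 2 with hZ2 | hZ2
    · rcases Nat.lt_or_ge Z 1 with h0 | h1
      · obtain rfl : Z = 0 := by omega
        simp [hB]
      · obtain rfl : Z = 1 := by omega
        simpa using h 1 1 le_rfl le_rfl le_rfl hZ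
    · have hlog : Nat.log 2 Z = Nat.log 2 (Z / 2) + 1 := Nat.log_of_one_lt_of_le one_lt_two hZ2
      have h1 := ih (Z / 2) (by omega) (by omega)
      -- With the halving rounded down, the upper half still satisfies Z + 1 ≤ 2(⌊Z/2⌋ + 1).
      have h2 := h (Z / 2 + 1) Z (by omega) (by omega) (by omega) hZ
      have e : ∑ m ∈ Finset.Icc 1 Z, f m
          = ∑ m ∈ Finset.Icc 1 (Z / 2), f m + ∑ m ∈ Finset.Icc (Z / 2 + 1) Z, f m := by
        have e1 : Finset.Icc 1 Z = Finset.Ioc 0 Z := Finset.Icc_add_one_left_eq_Ioc 0 Z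
        have e2 : Finset.Icc 1 (Z / 2) = Finset.Ioc 0 (Z / 2) :=
          Finset.Icc_add_one_left_eq_Ioc 0 (Z / 2)
        rw [Finset.Icc_add_one_left_eq_Ioc, e1, e2]
        exact (Finset.sum_Ioc_consecutive f (Nat.zero_le _) (Nat.div_le_self Z 2)).symm
      rw [e, hlog]
      refine (abs_add_le _ _).trans ?_
      push_cast
      linarith

lemma natLog_two_le {M : ℕ} (hM : 1 ≤ M) : (Nat.log 2 M : ℝ) ≤ 2 * Real.log M := by
  have h1 : ((2 : ℝ) ^ Nat.log 2 M) ≤ M := by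
    exact_mod_cast Nat.pow_log_le_self 2 (by omega)
  have h2 := Real.log_le_log (by positivity) h1
  rw [Real.log_pow] at h2
  have := Real.log_two_gt_d9
  have h0 : (0 : ℝ) ≤ Nat.log 2 M := by positivity
  nlinarith

/-! ### The main term from the interval lengths -/

lemma rpow_add_one_sub_bounds {a x y : ℝ} (ha : a ≤ 0) (ha1 : a + 1 ≠ 0) (hx : 0 < x)
    (hxy : x < y) :
    y ^ a * (y - x) ≤ (y ^ (a + 1) - x ^ (a + 1)) / (a + 1) ∧
      (y ^ (a + 1) - x ^ (a + 1)) / (a + 1) ≤ x ^ a * (y - x) := by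
  have hd : ∀ z : ℝ, 0 < z → HasDerivAt (fun z : ℝ => z ^ (a + 1) / (a + 1)) (z ^ a) z := by
    intro z hz
    have := (Real.hasDerivAt_rpow_const (p := a + 1) (Or.inl hz.ne')).div_const (a + 1)
    refine this.congr_deriv ?_
    rw [add_sub_cancel_right, mul_div_cancel_left₀ _ ha1]
  obtain ⟨z, ⟨hz1, hz2⟩, hz⟩ := exists_hasDerivAt_eq_slope
    (fun z : ℝ => z ^ (a + 1) / (a + 1)) (fun z => z ^ a) hxy
    (fun z hz => (hd z (hx.trans_le hz.1)).continuousAt.continuousWithinAt)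
    (fun z hz => hd z (hx.trans hz.1))
  have hyx : 0 < y - x := sub_pos.2 hxy
  have e : (y ^ (a + 1) - x ^ (a + 1)) / (a + 1) = z ^ a * (y - x) := by
    rw [hz, div_mul_cancel₀ _ hyx.ne', sub_div]
  rw [e]
  exact ⟨mul_le_mul_of_nonneg_right
      (Real.rpow_le_rpow_of_nonpos (hx.trans hz1) hz2.le ha) hyx.le,
    mul_le_mul_of_nonneg_right (Real.rpow_le_rpow_of_nonpos hx hz1.le ha) hyx.le⟩

lemma mul_sq_rpow {s x : ℝ} (hs : 0 ≤ s) (hx : 0 ≤ x) (a : ℝ) :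
    (s * x ^ 2) ^ a = s ^ a * x ^ (2 * a) := by
  rw [Real.mul_rpow hs (by positivity), ← Real.rpow_natCast, ← Real.rpow_mul hx]
  norm_num

/-- The total length of the intervals `[leftEnd, rightEnd)`. -/
lemma abs_sum_length_sub_le {γ : ℝ} (hγ0 : 0 < γ) (hγ1 : γ < 1) (hγ2 : γ ≠ 1 / 2) {s : ℕ}
    (hs : 1 ≤ s) {R : ℝ} (hR : 1 ≤ R) :
    |∑ m ∈ Finset.Icc 1 ⌊R⌋₊, (rightEnd γ s m - leftEnd γ s m)
        - γ * (2 * γ - 1)⁻¹ * ((s : ℝ) ^ (γ - 1) * R ^ (2 * γ - 1))|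
      ≤ (2 + |(2 * γ - 1)⁻¹|) * (s : ℝ) ^ (γ - 1) := by
  have hs' : (1 : ℝ) ≤ s := by exact_mod_cast hs
  have hb : 2 * γ - 1 ≠ 0 := fun h => hγ2 (by linarith)
  set M := ⌊R⌋₊ with hM
  have hM1 : 1 ≤ M := Nat.le_floor (by simpa using hR)
  have hMR : (M : ℝ) ≤ R := Nat.floor_le (by linarith)
  have hRM : R < M + 1 := Nat.lt_floor_add_one R
  have hsp : 0 < (s : ℝ) ^ (γ - 1) := by positivity
  set G : ℝ → ℝ := fun x => x ^ (2 * γ - 1) / (2 * γ - 1) with hG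
  have hGb : ∀ x y : ℝ, 0 < x → x < y → y ^ (2 * γ - 2) * (y - x) ≤ G y - G x ∧
      G y - G x ≤ x ^ (2 * γ - 2) * (y - x) := by
    intro x y hx hxy
    have := rpow_add_one_sub_bounds (a := 2 * γ - 2) (by linarith)
      (by intro h; exact hb (by linarith)) hx hxy
    rw [show 2 * γ - 2 + 1 = 2 * γ - 1 by ring, sub_div] at this
    exact this
  -- The length and its model γ s^(γ-1) (G(m+1) - G(m)) lie between the same two bounds, γ s^(γ-1)
  -- times (m+1)^(2γ-2) and m^(2γ-2). So their distance is at most the gap, which telescopes.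
  have term : ∀ m ∈ Finset.Icc 1 M,
      |rightEnd γ s m - leftEnd γ s m
          - γ * (s : ℝ) ^ (γ - 1) * (G ((m + 1 : ℕ) : ℝ) - G (m : ℝ))|
        ≤ γ * (s : ℝ) ^ (γ - 1)
          * (-((m + 1 : ℕ) : ℝ) ^ (2 * γ - 2) - -(m : ℝ) ^ (2 * γ - 2)) := by
    intro m hm
    have hm1 : (1 : ℝ) ≤ m := by exact_mod_cast (Finset.mem_Icc.1 hm).1
    have g := hGb m ((m + 1 : ℕ) : ℝ) (by linarith) (by push_cast; linarith)
    have u := rpow_add_one_sub_bounds (a := γ - 1) (x := (s : ℝ) * (m : ℝ) ^ 2)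
      (y := (s : ℝ) * (m : ℝ) ^ 2 + 1) (by linarith) (by linarith) (by positivity) (by linarith)
    rw [sub_add_cancel, add_sub_cancel_left, mul_one, mul_one, mul_sq_rpow (by linarith)
      (by linarith) (γ - 1)] at u
    have hnext : (s : ℝ) ^ (γ - 1) * ((m + 1 : ℕ) : ℝ) ^ (2 * γ - 2)
        ≤ ((s : ℝ) * (m : ℝ) ^ 2 + 1) ^ (γ - 1) := by
      rw [show 2 * γ - 2 = 2 * (γ - 1) by ring, ← mul_sq_rpow (by linarith) (by positivity)]
      refine Real.rpow_le_rpow_of_nonpos (by positivity) ?_ (by linarith)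
      push_cast
      nlinarith
    rw [show 2 * (γ - 1) = 2 * γ - 2 by ring] at u
    have u1 := mul_le_mul_of_nonneg_left (hnext.trans u.1) hγ0.le
    have u2 := mul_le_mul_of_nonneg_left u.2 hγ0.le
    rw [mul_div_cancel₀ _ hγ0.ne'] at u1 u2
    have e1 : ((m + 1 : ℕ) : ℝ) - m = 1 := by push_cast; ring
    rw [e1, mul_one, mul_one] at g
    have g1 := mul_le_mul_of_nonneg_left g.1 (by positivity : 0 ≤ γ * (s : ℝ) ^ (γ - 1))
    have g2 := mul_le_mul_of_nonneg_left g.2 (by positivity : 0 ≤ γ * (s : ℝ) ^ (γ - 1))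
    rw [abs_le, rightEnd, leftEnd]
    constructor <;> linarith
  have tot := (Finset.abs_sum_le_sum_abs _ _).trans (Finset.sum_le_sum term)
  rw [Finset.sum_sub_distrib, ← Finset.mul_sum, ← Finset.mul_sum,
    sum_Icc_succ_sub (fun m => G (m : ℝ)) hM1,
    sum_Icc_succ_sub (fun m => -(m : ℝ) ^ (2 * γ - 2)) hM1] at tot
  have hlast : 0 ≤ ((M + 1 : ℕ) : ℝ) ^ (2 * γ - 2) := by positivity
  have hG1 : G ((1 : ℕ) : ℝ) = (2 * γ - 1)⁻¹ := by simp [hG]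
  have hGR : |G ((M + 1 : ℕ) : ℝ) - G R| ≤ 1 := by
    have g := hGb R ((M + 1 : ℕ) : ℝ) (by linarith) (by push_cast; linarith)
    have hR1 : R ^ (2 * γ - 2) ≤ 1 := Real.rpow_le_one_of_one_le_of_nonpos hR (by linarith)
    have hd : ((M + 1 : ℕ) : ℝ) - R ≤ 1 := by push_cast; linarith
    have hd0 : 0 ≤ ((M + 1 : ℕ) : ℝ) - R := by push_cast; linarith
    rw [abs_of_nonneg (le_trans (by positivity) g.1)]
    exact g.2.trans (mul_le_one₀ hR1 hd0 hd)
  have hmain : γ * (2 * γ - 1)⁻¹ * ((s : ℝ) ^ (γ - 1) * R ^ (2 * γ - 1))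
      = γ * (s : ℝ) ^ (γ - 1) * G R := by
    simp only [hG]; ring
  have hc0 : 0 ≤ γ * (s : ℝ) ^ (γ - 1) := by positivity
  have hc1 : γ * (s : ℝ) ^ (γ - 1) ≤ (s : ℝ) ^ (γ - 1) := by nlinarith
  rw [hmain]
  have t1 : γ * (s : ℝ) ^ (γ - 1) * (-((M + 1 : ℕ) : ℝ) ^ (2 * γ - 2)
      - -((1 : ℕ) : ℝ) ^ (2 * γ - 2)) ≤ γ * (s : ℝ) ^ (γ - 1) * 1 := by
    refine mul_le_mul_of_nonneg_left ?_ hc0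
    rw [Nat.cast_one, Real.one_rpow]
    linarith
  have t2 : |γ * (s : ℝ) ^ (γ - 1) * (G ((M + 1 : ℕ) : ℝ) - G ((1 : ℕ) : ℝ))
      - γ * (s : ℝ) ^ (γ - 1) * G R|
      ≤ γ * (s : ℝ) ^ (γ - 1) * (1 + |(2 * γ - 1)⁻¹|) := by
    rw [← mul_sub, abs_mul, abs_of_nonneg hc0, hG1]
    refine mul_le_mul_of_nonneg_left ?_ hc0
    rw [sub_right_comm]
    exact (abs_sub _ _).trans (by linarith)
  calc _ ≤ _ := abs_sub_le _
          (γ * (s : ℝ) ^ (γ - 1) * (G ((M + 1 : ℕ) : ℝ) - G ((1 : ℕ) : ℝ))) _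
    _ ≤ γ * (s : ℝ) ^ (γ - 1) * 1 + γ * (s : ℝ) ^ (γ - 1) * (1 + |(2 * γ - 1)⁻¹|) :=
        add_le_add (tot.trans t1) t2
    _ = γ * (s : ℝ) ^ (γ - 1) * (2 + |(2 * γ - 1)⁻¹|) := by ring
    _ ≤ (s : ℝ) ^ (γ - 1) * (2 + |(2 * γ - 1)⁻¹|) := by gcongr
    _ = _ := mul_comm _ _

/-! ### The exact formula for the count -/

lemma mem_Ico_ceil_iff {c : ℝ} (hc : 0 < c) (s m n : ℕ) :
    n ∈ Finset.Ico ⌈leftEnd c⁻¹ s m⌉₊ ⌈rightEnd c⁻¹ s m⌉₊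
      ↔ ⌊(n : ℝ) ^ c⌋ = (s : ℤ) * (m : ℤ) ^ 2 := by
  rw [Finset.mem_Ico, Nat.ceil_le, Nat.lt_ceil, leftEnd, rightEnd,
    Real.rpow_inv_le_iff_of_pos (by positivity) (by positivity) hc,
    Real.lt_rpow_inv_iff_of_pos (by positivity) (by positivity) hc, Int.floor_eq_iff]
  push_cast
  rfl

lemma squareCount_eq_sum {c : ℝ} (hc : 1 < c) {s : ℕ} (hs : 1 ≤ s) (N : ℕ) :
    (SquareCount c s N : ℝ) = ∑ m ∈ Finset.Icc 1 ⌊√((N : ℝ) ^ c / s)⌋₊,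
      ((⌈rightEnd c⁻¹ s m⌉ - ⌈leftEnd c⁻¹ s m⌉ : ℤ) : ℝ) := by
  classical
  have hc0 : 0 < c := by linarith
  have hs' : (0 : ℝ) < s := by exact_mod_cast hs
  have hle : ∀ m : ℕ, m ≤ ⌊√((N : ℝ) ^ c / s)⌋₊ ↔ (s : ℝ) * (m : ℝ) ^ 2 ≤ (N : ℝ) ^ c := by
    intro m
    rw [Nat.le_floor_iff (Real.sqrt_nonneg _), Real.le_sqrt (by positivity), le_div_iff₀ hs', mul_comm]
    positivity
  have hset : ((Finset.Icc 1 N).filter fun n : ℕ => ∃ m : ℤ, ⌊(n : ℝ) ^ c⌋ = (s : ℤ) * m ^ 2)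
      = (Finset.Icc 1 ⌊√((N : ℝ) ^ c / s)⌋₊).biUnion
        (fun m => Finset.Ico ⌈leftEnd c⁻¹ s m⌉₊ ⌈rightEnd c⁻¹ s m⌉₊) := by
    ext n
    simp only [Finset.mem_filter, Finset.mem_biUnion, mem_Ico_ceil_iff hc0, Finset.mem_Icc, hle]
    constructor
    · rintro ⟨⟨h1, h2⟩, k, hk⟩
      refine ⟨k.natAbs, ⟨?_, ?_⟩, by rw [hk]; simp⟩
      · by_contra h0
        have hk0 : k = 0 := by omega
        rw [hk0] at hk
        have h3 : (1 : ℤ) ≤ ⌊(n : ℝ) ^ c⌋ := by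
          rw [Int.le_floor]
          exact_mod_cast Real.one_le_rpow (by exact_mod_cast h1) hc0.le
        simp [hk] at h3
      · have h3 : (s : ℝ) * ((k.natAbs : ℕ) : ℝ) ^ 2 ≤ (n : ℝ) ^ c := by
          have h4 := Int.floor_le ((n : ℝ) ^ c)
          rw [hk] at h4
          push_cast at h4
          rwa [Nat.cast_natAbs, Int.cast_abs, sq_abs]
        exact h3.trans (Real.rpow_le_rpow (by positivity) (by exact_mod_cast h2) hc0.le)
    · rintro ⟨m, ⟨h1, h2⟩, h3⟩
      have h4 := Int.floor_eq_iff.1 h3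
      push_cast at h4
      have hm : (1 : ℝ) ≤ m := by exact_mod_cast h1
      refine ⟨⟨?_, ?_⟩, m, h3⟩
      · by_contra h0
        obtain rfl : n = 0 := by omega
        rw [Nat.cast_zero, Real.zero_rpow hc0.ne'] at h4
        have : 0 < (s : ℝ) * (m : ℝ) ^ 2 := by positivity
        linarith
      -- There is no boundary correction at m near R: n^c < s m² + 1 ≤ N^c + 1 ≤ (N + 1)^c forces n
      -- ≤ N.
      · have h5 : (N : ℝ) ^ c + 1 ≤ ((N : ℝ) + 1) ^ c := by
          simpa using Real.add_rpow_le_rpow_add (by positivity : (0 : ℝ) ≤ N) zero_le_one hc.le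
        have h6 : (n : ℝ) ^ c < ((N : ℝ) + 1) ^ c := by linarith
        have h7 := (Real.rpow_lt_rpow_iff (by positivity) (by positivity) hc0).1 h6
        exact Nat.lt_succ_iff.1 (by exact_mod_cast h7)
  have hcard : SquareCount c s N = ∑ m ∈ Finset.Icc 1 ⌊√((N : ℝ) ^ c / s)⌋₊,
      (Finset.Ico ⌈leftEnd c⁻¹ s m⌉₊ ⌈rightEnd c⁻¹ s m⌉₊).card := by
    rw [← Finset.card_biUnion, ← hset, SquareCount]
    · intro m _ m' _ hne
      rw [Function.onFun, Finset.disjoint_left]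
      intro n hn hn'
      rw [mem_Ico_ceil_iff hc0] at hn hn'
      rw [hn] at hn'
      have h1 := mul_left_cancel₀ (by exact_mod_cast (by omega : s ≠ 0)) hn'
      exact hne (Nat.pow_left_injective two_ne_zero (by exact_mod_cast h1))
  rw [hcard, Nat.cast_sum]
  refine Finset.sum_congr rfl fun m _ => ?_
  have hl : 0 ≤ leftEnd c⁻¹ s m := by unfold leftEnd; positivity
  have hlr := leftEnd_le_rightEnd (inv_nonneg.2 hc0.le) s m
  rw [Nat.card_Ico, Nat.cast_sub (Nat.ceil_mono hlr), Int.cast_sub,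
    natCast_ceil_eq_intCast_ceil hl, natCast_ceil_eq_intCast_ceil (hl.trans hlr)]

/-! ### Absorbing logarithms and assembling the estimate -/

lemma tendsto_log_one_add_log_div_log :
    Tendsto (fun N : ℕ => 2 * Real.log (1 + Real.log N) / Real.log N) atTop (𝓝 0) := by
  have h1 : Tendsto (fun x : ℝ => Real.log (1 + x) / x) atTop (𝓝 0) := by
    have h2 : (fun x : ℝ => Real.log (1 + x)) =o[atTop] fun x : ℝ => x := by
      have h3 := Real.isLittleO_log_id_atTop.comp_tendsto (tendsto_atTop_add_const_left atTop (1 : ℝ)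
        tendsto_id)
      refine h3.trans_isBigO (Asymptotics.IsBigO.of_bound 2 ?_)
      filter_upwards [eventually_ge_atTop (1 : ℝ)] with x hx
      simp only [Function.comp, id, Real.norm_eq_abs]
      rw [abs_of_pos (by linarith), abs_of_pos (by linarith)]
      linarith
    exact h2.tendsto_div_nhds_zero
  have h2 := (h1.comp (Real.tendsto_log_atTop.comp tendsto_natCast_atTop_atTop)).const_mul 2
  rw [mul_zero] at h2
  refine h2.congr fun N => ?_
  simp only [Function.comp]
  ring

lemma rpow_eq_one_add_log_sq {N : ℕ} (hN : 1 ≤ N) :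
    (N : ℝ) ^ (2 * Real.log (1 + Real.log N) / Real.log N) = (1 + Real.log N) ^ 2 := by
  have hN' : (1 : ℝ) ≤ N := by exact_mod_cast hN
  have hlog := Real.log_nonneg hN'
  -- At N = 1 the exponent is 0 by division by zero, and both sides are 1.
  rcases hlog.eq_or_lt with h | h
  · rw [← h]; simp
  · rw [Real.rpow_def_of_pos (by linarith), mul_div_cancel₀ _ h.ne', mul_comm, Real.exp_mul,
      Real.exp_log (by linarith)]
    norm_num

/-- The sum of all the errors. -/
lemma exists_abs_sum_gapError_floor_le {γ κ l : ℝ} (hγ0 : 0 < γ) (hγ1 : γ < 1)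
    (hγ2 : γ ≠ 1 / 2) (hpair : IsExponentPair (1 - 2 * γ) κ l) :
    ∃ K : ℝ, 0 < K ∧ ∀ (s : ℕ) (R : ℝ), 1 ≤ s → 1 ≤ R →
      |∑ m ∈ Finset.Icc 1 ⌊R⌋₊, gapError γ s m|
        ≤ K * (1 + Real.log R) ^ 2 * errorSize κ l R (((s : ℝ) * R ^ 2) ^ γ) := by
  obtain ⟨K, hK, hblock⟩ := exists_abs_sum_gapError_le hγ0 hγ1 hγ2 hpair
  obtain ⟨hκ0, -, hl0, -, -⟩ := hpair
  refine ⟨2 * K, by positivity, fun s R hs hR => ?_⟩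
  have hs' : (1 : ℝ) ≤ s := by exact_mod_cast hs
  have hM1 : 1 ≤ ⌊R⌋₊ := Nat.le_floor (by simpa using hR)
  have hMR : (⌊R⌋₊ : ℝ) ≤ R := Nat.floor_le (by linarith)
  have hlogR : 0 ≤ Real.log R := Real.log_nonneg hR
  have hE0 : 0 ≤ errorSize κ l R (((s : ℝ) * R ^ 2) ^ γ) := by unfold errorSize; positivity
  have h := abs_sum_Icc_one_le_of_dyadic (f := gapError γ s) (M := ⌊R⌋₊)
    (B := K * (1 + Real.log R) * errorSize κ l R (((s : ℝ) * R ^ 2) ^ γ)) (by positivity)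
    (fun X Y hX hXY hY hYM => by
      have hX1 : (1 : ℝ) ≤ X := by exact_mod_cast hX
      have hXR : (X : ℝ) ≤ R := le_trans (by exact_mod_cast hXY.trans hYM) hMR
      have hEE : errorSize κ l X (leftEnd γ s X)
          ≤ errorSize κ l R (((s : ℝ) * R ^ 2) ^ γ) := by
        unfold errorSize leftEnd
        gcongr
      have hE1 : 0 ≤ errorSize κ l X (leftEnd γ s X) := by
        unfold errorSize leftEnd; positivity
      refine (hblock X Y s hX hXY hY hs).trans ?_
      have := Real.log_le_log (by linarith) hXR
      gcongr)
  refine h.trans ?_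
  have h1 := natLog_two_le hM1
  have h2 := Real.log_le_log (by exact_mod_cast hM1) hMR
  calc _ ≤ (2 * (1 + Real.log R))
        * (K * (1 + Real.log R) * errorSize κ l R (((s : ℝ) * R ^ 2) ^ γ)) := by
        gcongr
        linarith
    _ = _ := by ring

lemma sqrt_rpow {x : ℝ} (hx : 0 ≤ x) (a : ℝ) : √x ^ a = x ^ (a / 2) := by
  rw [Real.sqrt_eq_rpow, ← Real.rpow_mul hx]
  congr 1
  ring

lemma errorSize_sqrt_eq {c κ l : ℝ} (hκ : 0 ≤ κ) {s N : ℕ} (hs : 1 ≤ s)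
    (hN : 1 ≤ N) :
    errorSize κ l (√((N : ℝ) ^ c / s)) N
      = (s : ℝ) ^ (-rho₁ κ l) * (N : ℝ) ^ theta₁ c κ l := by
  have hs0 : (0 : ℝ) < s := by exact_mod_cast hs
  have hN0 : (0 : ℝ) < N := by exact_mod_cast hN
  have hk : 1 + κ ≠ 0 := by positivity
  have hk' : κ + 1 ≠ 0 := by positivity
  rw [errorSize, sqrt_rpow (by positivity), Real.div_rpow (by positivity) hs0.le,
    ← Real.rpow_mul hN0.le, div_eq_mul_inv, ← Real.rpow_neg hs0.le, mul_right_comm,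
    ← Real.rpow_add hN0, mul_comm]
  congr 2
  · rw [rho₁, div_div, add_comm κ, mul_comm 2]
  · rw [theta₁]
    field_simp
    ring

lemma main_term_eq {c : ℝ} (hc : c ≠ 0) {s N : ℕ} (hs : 1 ≤ s) (hN : 1 ≤ N) :
    (s : ℝ) ^ (c⁻¹ - 1) * √((N : ℝ) ^ c / s) ^ (2 * c⁻¹ - 1)
      = (s : ℝ) ^ (-(1 / 2) : ℝ) * (N : ℝ) ^ (1 - c / 2) := by
  have hs0 : (0 : ℝ) < s := by exact_mod_cast hs
  have hN0 : (0 : ℝ) < N := by exact_mod_cast hN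
  rw [sqrt_rpow (by positivity), Real.div_rpow (by positivity) hs0.le,
    ← Real.rpow_mul hN0.le, div_eq_mul_inv, ← Real.rpow_neg hs0.le, mul_left_comm,
    ← Real.rpow_add hs0, mul_comm]
  congr 2
  · ring
  · field_simp

/-- Here no m ≥ 1 is admissible, so the main term itself must be absorbed. With z = N^c/s ≤ 1 it is
√z N^(1-c), while the error is √z^(l/(1+κ)) N^(κ/(1+κ)); both factors compare. -/
lemma main_term_le {c κ l : ℝ} (hc : 1 < c) (hκ : 0 ≤ κ) (hl : l ≤ 1) {s N : ℕ}
    (hs : 1 ≤ s) (hN : 1 ≤ N) (hsN : (N : ℝ) ^ c < s) :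
    (s : ℝ) ^ (-(1 / 2) : ℝ) * (N : ℝ) ^ (1 - c / 2)
      ≤ (s : ℝ) ^ (-rho₁ κ l) * (N : ℝ) ^ theta₁ c κ l := by
  have hs0 : (0 : ℝ) < s := by exact_mod_cast hs
  have hN0 : (0 : ℝ) < N := by exact_mod_cast hN
  have hN1 : (1 : ℝ) ≤ N := by exact_mod_cast hN
  have hz0 : 0 < (N : ℝ) ^ c / s := by positivity
  have hz1 : (N : ℝ) ^ c / s ≤ 1 := (div_le_one hs0).2 hsN.le
  have hle : l / (1 + κ) ≤ 1 := by rw [div_le_one (by positivity)]; linarith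
  have e : (s : ℝ) ^ (-(1 / 2) : ℝ) * (N : ℝ) ^ (1 - c / 2)
      = √((N : ℝ) ^ c / s) ^ (1 : ℝ) * (N : ℝ) ^ (1 - c) := by
    rw [sqrt_rpow (by positivity), Real.div_rpow (by positivity) hs0.le,
      ← Real.rpow_mul hN0.le, div_eq_mul_inv (_ ^ _) (_ ^ _), ← Real.rpow_neg hs0.le, mul_right_comm,
      ← Real.rpow_add hN0, mul_comm]
    congr 2
    ring
  rw [e, ← errorSize_sqrt_eq hκ hs hN, errorSize]
  refine mul_le_mul (Real.rpow_le_rpow_of_exponent_ge (Real.sqrt_pos.2 hz0) ?_ hle) ?_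
    (by positivity) (by positivity)
  · rw [Real.sqrt_le_one]
    exact hz1
  · refine Real.rpow_le_rpow_of_exponent_le hN1 ?_
    have : 0 ≤ κ / (1 + κ) := by positivity
    linarith

theorem theorem2p1 (c γ : ℝ) (hc : 1 < c) (hcN : ∀ k : ℕ, c ≠ k) (hγ : γ = 1 / c)
    (κ l : ℝ) (hpair : IsExponentPair (1 - 2 * γ) κ l) :
    ∃ C : ℝ, 0 < C ∧ ∃ δ : ℕ → ℝ, Tendsto δ atTop (𝓝 0) ∧
      ∀ N s : ℕ, 1 ≤ N → 1 ≤ s →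
        |(SquareCount c s N : ℝ)
            - γ * (2 * γ - 1)⁻¹ * (s : ℝ) ^ (-(1 / 2) : ℝ) * (N : ℝ) ^ (1 - c / 2)|
          ≤ C * ((s : ℝ) ^ (-rho₁ κ l) * (N : ℝ) ^ (theta₁ c κ l + δ N)
              + (s : ℝ) ^ (-rho₂ κ l) * (N : ℝ) ^ (theta₂ c κ l + δ N)) := by
  have hc0 : 0 < c := by linarith
  have hγc : γ = c⁻¹ := by rw [hγ, one_div]
  subst hγc
  have hγ0 : 0 < c⁻¹ := by positivity
  have hγ1 : c⁻¹ < 1 := inv_lt_one_of_one_lt₀ hc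
  have hγ2 : c⁻¹ ≠ 1 / 2 := by
    intro h
    refine hcN 2 ?_
    rw [one_div] at h
    exact_mod_cast inv_injective h
  obtain ⟨K, hK, hsum⟩ := exists_abs_sum_gapError_floor_le hγ0 hγ1 hγ2 hpair
  obtain ⟨hκ0, hκ1, hl0, hl1, -⟩ := hpair
  set D := 2 + |(2 * c⁻¹ - 1)⁻¹| with hD
  have hD0 : 0 < D := by positivity
  -- The factor c² comes from log R ≤ c log N. The constant D covers the error in the total length
  -- and, when N^c < s, the coefficient of the main term.
  refine ⟨K * c ^ 2 + D, by positivity,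
    fun N => 2 * Real.log (1 + Real.log N) / Real.log N, tendsto_log_one_add_log_div_log, ?_⟩
  intro N s hN hs
  have hN0 : (0 : ℝ) < N := by exact_mod_cast hN
  have hN1 : (1 : ℝ) ≤ N := by exact_mod_cast hN
  have hs0 : (0 : ℝ) < s := by exact_mod_cast hs
  have hs1 : (1 : ℝ) ≤ s := by exact_mod_cast hs
  have hlog : 0 ≤ Real.log N := Real.log_nonneg hN1
  have hL1 : 1 ≤ (1 + Real.log N) ^ 2 := one_le_pow₀ (by linarith)
  rw [Real.rpow_add hN0, Real.rpow_add hN0, rpow_eq_one_add_log_sq hN, mul_assoc _ _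
    ((N : ℝ) ^ (1 - c / 2))]
  set E := (s : ℝ) ^ (-rho₁ κ l) * (N : ℝ) ^ theta₁ c κ l with hE
  have hE0 : 0 < E := by positivity
  suffices H : |(SquareCount c s N : ℝ) - c⁻¹ * (2 * c⁻¹ - 1)⁻¹ *
      ((s : ℝ) ^ (-(1 / 2) : ℝ) * (N : ℝ) ^ (1 - c / 2))|
        ≤ (K * c ^ 2 + D) * ((1 + Real.log N) ^ 2 * E) by
    refine H.trans ?_
    refine mul_le_mul_of_nonneg_left ?_ (by positivity)
    -- The first error term already suffices; the second enters only through its nonnegativity.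
    have : 0 ≤ (s : ℝ) ^ (-rho₂ κ l) * ((N : ℝ) ^ theta₂ c κ l * (1 + Real.log N) ^ 2) := by
      positivity
    calc (1 + Real.log N) ^ 2 * E
        = (s : ℝ) ^ (-rho₁ κ l) * ((N : ℝ) ^ theta₁ c κ l * (1 + Real.log N) ^ 2) := by
          rw [hE]; ring
      _ ≤ _ := by linarith
  have hEL : E ≤ (1 + Real.log N) ^ 2 * E := le_mul_of_one_le_left hE0.le hL1
  rw [squareCount_eq_sum hc hs N]
  rcases lt_or_ge ((N : ℝ) ^ c) s with hsN | hsN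
  · have hR1 : √((N : ℝ) ^ c / s) < 1 := by
      rw [Real.sqrt_lt' one_pos, one_pow, div_lt_one hs0]
      exact hsN
    rw [Nat.floor_eq_zero.2 hR1]
    have h1 := main_term_le hc hκ0 hl1 hs hN hsN
    have h2 : |c⁻¹ * (2 * c⁻¹ - 1)⁻¹| ≤ D := by
      rw [abs_mul, abs_of_pos hγ0]
      have := abs_nonneg (2 * c⁻¹ - 1)⁻¹
      nlinarith
    simp only [Finset.Icc_eq_empty_of_lt one_pos, Finset.sum_empty, zero_sub, abs_neg]
    rw [abs_mul, abs_of_nonneg (by positivity : 0 ≤ (s : ℝ) ^ (-(1 / 2) : ℝ)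
      * (N : ℝ) ^ (1 - c / 2))]
    have hKc : 0 ≤ K * c ^ 2 := by positivity
    calc _ ≤ D * E := by gcongr
      _ ≤ (K * c ^ 2 + D) * ((1 + Real.log N) ^ 2 * E) := by gcongr; linarith
  · set R := √((N : ℝ) ^ c / s) with hR
    have hq1 : 1 ≤ (N : ℝ) ^ c / s := (one_le_div hs0).2 hsN
    have hR1 : 1 ≤ R := Real.one_le_sqrt.2 hq1
    have hRT : ((s : ℝ) * R ^ 2) ^ c⁻¹ = N := by
      rw [hR, Real.sq_sqrt (by positivity), mul_div_cancel₀ _ hs0.ne',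
        Real.rpow_rpow_inv hN0.le hc0.ne']
    have hlogR : Real.log R ≤ c * Real.log N := by
      rw [hR, Real.log_sqrt (by positivity), ← Real.log_rpow hN0]
      have h1 : Real.log ((N : ℝ) ^ c / s) ≤ Real.log ((N : ℝ) ^ c) :=
        Real.log_le_log (by positivity) (div_le_self (by positivity) hs1)
      have h2 := Real.log_nonneg hq1
      linarith
    have hlogR0 := Real.log_nonneg hR1
    have a1 := hsum s R hs hR1
    have a2 := abs_sum_length_sub_le hγ0 hγ1 hγ2 hs hR1
    rw [hRT, errorSize_sqrt_eq hκ0 hs hN, ← hE] at a1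
    rw [main_term_eq hc0.ne' hs hN, ← hD] at a2
    have hE1 : 1 ≤ E := by
      rw [hE, ← errorSize_sqrt_eq hκ0 hs hN]
      exact one_le_errorSize hκ0 hl0 hR1 hN1
    have hs2 : (s : ℝ) ^ (c⁻¹ - 1) ≤ 1 :=
      Real.rpow_le_one_of_one_le_of_nonpos hs1 (by linarith)
    have a3 : D * (s : ℝ) ^ (c⁻¹ - 1) ≤ D * ((1 + Real.log N) ^ 2 * E) := by
      gcongr
      linarith
    have a4 : K * (1 + Real.log R) ^ 2 * E ≤ K * c ^ 2 * ((1 + Real.log N) ^ 2 * E) := by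
      have : 1 + Real.log R ≤ c * (1 + Real.log N) := by linarith
      calc K * (1 + Real.log R) ^ 2 * E ≤ K * (c * (1 + Real.log N)) ^ 2 * E := by gcongr
        _ = _ := by ring
    have split : ∑ m ∈ Finset.Icc 1 ⌊R⌋₊, ((⌈rightEnd c⁻¹ s m⌉ - ⌈leftEnd c⁻¹ s m⌉ : ℤ) : ℝ)
        = ∑ m ∈ Finset.Icc 1 ⌊R⌋₊, gapError c⁻¹ s m
          + ∑ m ∈ Finset.Icc 1 ⌊R⌋₊, (rightEnd c⁻¹ s m - leftEnd c⁻¹ s m) := by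
      rw [← Finset.sum_add_distrib]
      exact Finset.sum_congr rfl fun m _ => by rw [gapError]; ring
    rw [split, add_sub_assoc]
    refine (abs_add_le _ _).trans ?_
    linarith
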